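/- Let $E_8$ be the $E_8$ root lattice and $O(E_8)$ its isometry group. Call $h\in O(E_8)$ rootless if $(h-1)E_8$ contains no root, i.e. no vector of norm $(x,x)=2$. For $n\ge 1$ let $A_n=\{x\in\mathbb Z^{n+1} : \sum_i x_i=0\}$ with the standard dot product, and let $h_{A_n}$ denote an $(n+1)$-cycle in its Weyl group $\mathrm{Sym}_{n+1}$, acting by permuting coordinates. **Theorem 4.23.** Let $h\in O(E_8)$ be a rootless element of order $6$. Then $h$ is conjugate in $O(E_8)$ to $h_{A_5}\oplus h_{A_2}\oplus h_{A_1}$. That is: $E_8$ contains a sublattice isometric to $A_5\perp A_2\perp A_1$, and for every identification of $A_5\perp A_2\perp A_1$ with a sublattice of $E_8$ (isometric embedding) and every choice of the cycles $h_{A_5},h_{A_2},h_{A_1}$, the isometry $h_{A_5}\oplus h_{A_2}\oplus h_{A_1}$ of that sublattice extends to an element of $O(E_8)$ to which $h$ is conjugate. -/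

import Mathlib

/-- The isometry group `O(L)` of a lattice `L` (a free abelian group `M` with an integral bilinear
form `B`): the automorphisms of the abelian group `M` that preserve `B`. -/
def isometryGroup {M : Type*} [AddCommGroup M] (B : LinearMap.BilinForm ℤ M) :
    Subgroup (M ≃ₗ[ℤ] M) where
  carrier := {g | ∀ x y, B (g x) (g y) = B x y}
  one_mem' := fun _ _ => rfl
  mul_mem' := fun {a b} ha hb x y => by
    change B (a (b x)) (a (b y)) = B x y
    rw [ha, hb]
  inv_mem' := fun {a} ha x y => by
    have h := ha (a⁻¹ x) (a⁻¹ y)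
    have hx : ∀ z, a (a⁻¹ z) = z := fun z => a.apply_symm_apply z
    rw [hx, hx] at h
    exact h.symm

/-- An isometry `h` of a lattice `L` is rootless if `(h - 1) L` contains no root, that is,
no vector of norm `2`. -/
def IsRootless {M : Type*} [AddCommGroup M] {B : LinearMap.BilinForm ℤ M}
    (h : isometryGroup B) : Prop :=
  ∀ x : M, B (h.1 x - x) (h.1 x - x) ≠ 2

/-- The form of the `E₈` lattice, realized on `ℤ⁸` (coordinates with respect to a system of simple
roots): its Gram matrix is the Cartan matrix of type `E₈`. -/
def formE8 : LinearMap.BilinForm ℤ (Fin 8 → ℤ) :=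
  Matrix.toBilin' CartanMatrix.E₈

/-- The standard model of the root lattice `A_n`: the integral vectors of length `n + 1` with
coordinate sum `0`. -/
def latticeA (n : ℕ) : Submodule ℤ (Fin (n + 1) → ℤ) where
  carrier := {x | ∑ i, x i = 0}
  zero_mem' := by simp
  add_mem' := fun {x y} hx hy => by
    simp only [Set.mem_ofPred_eq] at hx hy ⊢
    simp [Finset.sum_add_distrib, hx, hy]
  smul_mem' := fun c x hx => by
    simp only [Set.mem_ofPred_eq] at hx ⊢
    simp [← Finset.mul_sum, hx]

/-- The form of `A_n`: the restriction of the standard dot product. -/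
def formA (n : ℕ) : LinearMap.BilinForm ℤ (latticeA n) :=
  (Matrix.toBilin' (1 : Matrix (Fin (n + 1)) (Fin (n + 1)) ℤ)).restrict (latticeA n)

theorem formA_apply (n : ℕ) (x y : latticeA n) : formA n x y = ∑ i, x.1 i * y.1 i := by
  simp [formA, LinearMap.BilinForm.restrict_apply, Matrix.toBilin'_apply', dotProduct]

/-- The isometry of `A_n` given by a permutation `σ` of the coordinates (sending `e_i` to
`e_{σ i}`); these isometries form the Weyl group of `A_n`, identified with `Sym_{n+1}`. -/
def permA {n : ℕ} (σ : Equiv.Perm (Fin (n + 1))) : isometryGroup (formA n) :=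
  ⟨{ toFun := fun x => ⟨fun i => x.1 (σ.symm i), by
        change ∑ i, x.1 (σ.symm i) = 0
        rw [Equiv.sum_comp σ.symm x.1]
        exact x.2⟩
     invFun := fun x => ⟨fun i => x.1 (σ i), by
        change ∑ i, x.1 (σ i) = 0
        rw [Equiv.sum_comp σ x.1]
        exact x.2⟩
     map_add' := fun _ _ => rfl
     map_smul' := fun _ _ => rfl
     left_inv := fun x => by
        ext i
        simp
     right_inv := fun x => by
        ext i
        simp },
   fun x y => by
     rw [formA_apply, formA_apply]
     exact Equiv.sum_comp σ.symm (fun i => x.1 i * y.1 i)⟩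

/-- `h` is an `h_{A_n}`: an `(n+1)`-cycle in the Weyl group `Sym_{n+1}` of `A_n`. -/
def IsHA {n : ℕ} (h : isometryGroup (formA n)) : Prop :=
  ∃ σ : Equiv.Perm (Fin (n + 1)), σ.IsCycle ∧ σ.support = Finset.univ ∧ h = permA σ

/-- The form of the orthogonal sum of two lattices. -/
def orthSum {M N : Type*} [AddCommGroup M] [AddCommGroup N]
    (B : LinearMap.BilinForm ℤ M) (C : LinearMap.BilinForm ℤ N) :
    LinearMap.BilinForm ℤ (M × N) :=
  B.compl₁₂ (LinearMap.fst ℤ M N) (LinearMap.fst ℤ M N) +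
    C.compl₁₂ (LinearMap.snd ℤ M N) (LinearMap.snd ℤ M N)

theorem orthSum_apply {M N : Type*} [AddCommGroup M] [AddCommGroup N]
    (B : LinearMap.BilinForm ℤ M) (C : LinearMap.BilinForm ℤ N) (x y : M × N) :
    orthSum B C x y = B x.1 y.1 + C x.2 y.2 := rfl

/-- The direct sum `g ⊕ k` of two isometries, acting on the orthogonal sum of the lattices. -/
def isometrySum {M N : Type*} [AddCommGroup M] [AddCommGroup N]
    {B : LinearMap.BilinForm ℤ M} {C : LinearMap.BilinForm ℤ N}
    (g : isometryGroup B) (k : isometryGroup C) : isometryGroup (orthSum B C) :=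
  ⟨g.1.prodCongr k.1, fun x y => by
    rw [orthSum_apply, orthSum_apply]
    exact congrArg₂ (· + ·) (g.2 x.1 y.1) (k.2 x.2 y.2)⟩

/-- A homomorphism of lattices that preserves the forms. For a positive definite source it is
injective, hence identifies the source with a sublattice of the target. -/
def IsIsometric {M N : Type*} [AddCommGroup M] [AddCommGroup N]
    (B : LinearMap.BilinForm ℤ M) (C : LinearMap.BilinForm ℤ N) (φ : M →ₗ[ℤ] N) : Prop :=
  ∀ x y, C (φ x) (φ y) = B x y

/-! The proof finds the sublattice `A₅ ⊥ A₂ ⊥ A₁` inside `E₈` from the orbits of `h` on roots, and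
then shows that such sublattices, with their Coxeter elements, form a single orbit under isometries.

For a root `r`, rootlessness says that `(r, hr)` is never `1`. It passes to `h²` and `h³`, whose
differences with `1` factor through `h - 1`, so the inner products in an orbit take few patterns
(`IsRootless.orbit_type`). One of them makes the six vectors of the orbit an extended Dynkin diagram
of type `A₅`. That it occurs is a counting argument. The roots of `E₈` form a spherical design, so
the sums of `(r, gr)` and `(r, gr)²` over roots are polynomials in `tr g` and `tr g²`. Applied to
`h`, `h²`, `h³`, together with the congruences `tr g^p ≡ tr g` mod `p`, this leaves finitely many
traces, and each contradicts the absence of the pattern (`IsRootless.exists_orbit_A5`).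

An `A₅` chain of roots can be moved by reflections to the lowest root followed by simple roots
(`exists_isometry_chain`). The roots orthogonal to it form `A₂ + A₁`, which `h` permutes.
Integrality and rootlessness rule out every action on them except a Coxeter element of `A₂` and `-1`
on `A₁` (`IsRootless.exists_frame`).

For uniqueness, unimodularity supplies a glue vector that, after a possible sign change on `A₂`,
completes a frame of type `A₅ + A₂ + A₁` to the extended diagram of `E₈`
(`IsFrame.exists_isometry`). The sign change commutes with the Coxeter element, and a frame spans
rationally, so isometries acting as Coxeter elements on frames are conjugate (`isConj_of_actsOn`).
The prescribed isometries of the sublattice extend because they are products of reflections in roots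
(`exists_extension_permA`), and all full cycles are conjugate in the symmetric group. -/

/-! ### Positive definiteness of the form -/

theorem formE8_apply (x y : Fin 8 → ℤ) : formE8 x y =
    x 0 * (2 * y 0 - y 2) + x 1 * (2 * y 1 - y 3) + x 2 * (2 * y 2 - y 0 - y 3) +
    x 3 * (2 * y 3 - y 1 - y 2 - y 4) + x 4 * (2 * y 4 - y 3 - y 5) +
    x 5 * (2 * y 5 - y 4 - y 6) + x 6 * (2 * y 6 - y 5 - y 7) + x 7 * (2 * y 7 - y 6) := by
  simp [formE8, Matrix.toBilin'_apply', CartanMatrix.E₈, Matrix.mulVec, dotProduct,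
    Fin.sum_univ_eight]
  ring

theorem formE8_comm (x y : Fin 8 → ℤ) : formE8 x y = formE8 y x := by
  rw [formE8_apply, formE8_apply]; ring

/-- Completing squares along the three arms of the Dynkin diagram, from their ends to the branch
node `3`, leaves `2 - 2/3 - 1/2 - 4/5 = 1/30` as the coefficient of `x 3 ^ 2`; the factor `60`
clears denominators. -/
theorem formE8_sum_sq (x : Fin 8 → ℤ) : 60 * formE8 x x =
    30 * (2 * x 0 - x 2) ^ 2 + 10 * (3 * x 2 - 2 * x 3) ^ 2 + 30 * (2 * x 1 - x 3) ^ 2 +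
    30 * (2 * x 7 - x 6) ^ 2 + 10 * (3 * x 6 - 2 * x 5) ^ 2 + 5 * (4 * x 5 - 3 * x 4) ^ 2 +
    3 * (5 * x 4 - 4 * x 3) ^ 2 + 2 * x 3 ^ 2 := by
  rw [formE8_apply]; ring

theorem formE8_self_nonneg (x : Fin 8 → ℤ) : 0 ≤ formE8 x x := by
  have h := formE8_sum_sq x
  have : 0 ≤ 60 * formE8 x x := by rw [h]; positivity
  linarith

theorem formE8_self_eq_zero {x : Fin 8 → ℤ} (h0 : formE8 x x = 0) : x = 0 := by
  have h := formE8_sum_sq x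
  rw [h0] at h
  have e3 : x 3 ^ 2 = 0 := by
    nlinarith [sq_nonneg (2 * x 0 - x 2), sq_nonneg (3 * x 2 - 2 * x 3), sq_nonneg (2 * x 1 - x 3),
      sq_nonneg (2 * x 7 - x 6), sq_nonneg (3 * x 6 - 2 * x 5), sq_nonneg (4 * x 5 - 3 * x 4),
      sq_nonneg (5 * x 4 - 4 * x 3), sq_nonneg (x 3)]
  have e4 : (5 * x 4 - 4 * x 3) ^ 2 = 0 := by
    nlinarith [sq_nonneg (2 * x 0 - x 2), sq_nonneg (3 * x 2 - 2 * x 3), sq_nonneg (2 * x 1 - x 3),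
      sq_nonneg (2 * x 7 - x 6), sq_nonneg (3 * x 6 - 2 * x 5), sq_nonneg (4 * x 5 - 3 * x 4),
      sq_nonneg (5 * x 4 - 4 * x 3)]
  have e5 : (4 * x 5 - 3 * x 4) ^ 2 = 0 := by
    nlinarith [sq_nonneg (2 * x 0 - x 2), sq_nonneg (3 * x 2 - 2 * x 3), sq_nonneg (2 * x 1 - x 3),
      sq_nonneg (2 * x 7 - x 6), sq_nonneg (3 * x 6 - 2 * x 5), sq_nonneg (4 * x 5 - 3 * x 4)]
  have e6 : (3 * x 6 - 2 * x 5) ^ 2 = 0 := by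
    nlinarith [sq_nonneg (2 * x 0 - x 2), sq_nonneg (3 * x 2 - 2 * x 3), sq_nonneg (2 * x 1 - x 3),
      sq_nonneg (2 * x 7 - x 6), sq_nonneg (3 * x 6 - 2 * x 5)]
  have e7 : (2 * x 7 - x 6) ^ 2 = 0 := by
    nlinarith [sq_nonneg (2 * x 0 - x 2), sq_nonneg (3 * x 2 - 2 * x 3), sq_nonneg (2 * x 1 - x 3),
      sq_nonneg (2 * x 7 - x 6)]
  have e1 : (2 * x 1 - x 3) ^ 2 = 0 := by
    nlinarith [sq_nonneg (2 * x 0 - x 2), sq_nonneg (3 * x 2 - 2 * x 3), sq_nonneg (2 * x 1 - x 3)]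
  have e2 : (3 * x 2 - 2 * x 3) ^ 2 = 0 := by
    nlinarith [sq_nonneg (2 * x 0 - x 2), sq_nonneg (3 * x 2 - 2 * x 3)]
  have e0 : (2 * x 0 - x 2) ^ 2 = 0 := by linarith
  rw [sq_eq_zero_iff] at e0 e1 e2 e3 e4 e5 e6 e7
  ext i
  fin_cases i <;> simp <;> omega

/-! ### Reflections, and isometries determined by a Gram matrix -/

/-- The reflection in a vector of norm `2`. -/
def reflectionIso {M : Type*} [AddCommGroup M] {B : LinearMap.BilinForm ℤ M}
    (hB : ∀ x y, B x y = B y x) (r : M) (hr : B r r = 2) : isometryGroup B :=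
  have inv : ∀ x, (x - B r x • r) - B r (x - B r x • r) • r = x := fun x => by
    simp only [map_sub, map_smul, hr, smul_eq_mul, sub_smul, mul_smul]
    module
  ⟨{ toFun := fun x => x - B r x • r
     invFun := fun x => x - B r x • r
     map_add' := fun x y => by simp only [map_add, add_smul]; abel
     map_smul' := fun c x => by simp [smul_sub, mul_smul]
     left_inv := inv
     right_inv := inv },
   fun x y => by
     change B (x - B r x • r) (y - B r y • r) = B x y
     simp only [map_sub, map_smul, LinearMap.sub_apply, LinearMap.smul_apply, smul_eq_mul, hr,
       hB x r]
     ring⟩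

theorem reflectionIso_apply {M : Type*} [AddCommGroup M] {B : LinearMap.BilinForm ℤ M}
    (hB : ∀ x y, B x y = B y x) (r : M) (hr : B r r = 2) (x : M) :
    (reflectionIso hB r hr).1 x = x - B r x • r := rfl

/-- The inverse of the Cartan matrix of type `E₈`. -/
def invCartanE8 : Matrix (Fin 8) (Fin 8) ℕ :=
  !![4, 5, 7, 10, 8, 6, 4, 2;
     5, 8, 10, 15, 12, 9, 6, 3;
     7, 10, 14, 20, 16, 12, 8, 4;
     10, 15, 20, 30, 24, 18, 12, 6;
     8, 12, 16, 24, 20, 15, 10, 5;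
     6, 9, 12, 18, 15, 12, 8, 4;
     4, 6, 8, 12, 10, 8, 6, 3;
     2, 3, 4, 6, 5, 4, 3, 2]

theorem cartan_mul_inv : CartanMatrix.E₈ * invCartanE8.map (Nat.cast : ℕ → ℤ) = 1 := by
  decide +kernel

theorem inv_mul_cartan : invCartanE8.map (Nat.cast : ℕ → ℤ) * CartanMatrix.E₈ = 1 := by
  decide +kernel

theorem formE8_eq_dotProduct (x y : Fin 8 → ℤ) :
    formE8 x y = x ⬝ᵥ (CartanMatrix.E₈.mulVec y) := by
  simp [formE8, Matrix.toBilin'_apply']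

/-- Vectors with the Gram matrix of the simple roots are the images of the simple roots under an
isometry. -/
theorem exists_isometry_of_gram (E : Fin 8 → Fin 8 → ℤ)
    (hE : ∀ i j, formE8 (E i) (E j) = CartanMatrix.E₈ i j) :
    ∃ g : isometryGroup formE8, ∀ i, g.1 (Pi.single i 1) = E i := by
  set G : Matrix (Fin 8) (Fin 8) ℤ := (Matrix.of E).transpose with hG
  have h1 : G.transpose * CartanMatrix.E₈ * G = CartanMatrix.E₈ := by
    ext i j
    rw [← hE, formE8_eq_dotProduct, Matrix.mul_assoc]
    rfl
  -- Preservation of a unimodular form gives an integral left inverse, which for square matrices is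
  -- two-sided.
  have h2 : (invCartanE8.map (Nat.cast : ℕ → ℤ) * G.transpose * CartanMatrix.E₈) * G = 1 := by
    rw [Matrix.mul_assoc, Matrix.mul_assoc, ← Matrix.mul_assoc G.transpose, h1, inv_mul_cartan]
  have h3 := mul_eq_one_comm.mp h2
  refine ⟨⟨Matrix.toLin'OfInv h2 h3, fun x y => ?_⟩, fun i => ?_⟩
  · change formE8 (G.mulVec x) (G.mulVec y) = _
    rw [formE8_eq_dotProduct, formE8_eq_dotProduct, dotProduct_comm, Matrix.dotProduct_mulVec,
      dotProduct_comm, ← Matrix.mulVec_transpose, Matrix.mulVec_mulVec, Matrix.mulVec_mulVec,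
      h1]
  · change G.mulVec (Pi.single i 1) = _
    ext j
    simp [hG]

/-! ### Moments of the positive roots -/

/-- The positive roots of `E₈`, in coordinates with respect to the simple roots. -/
def posRows : List (List ℕ) := [
  [0, 0, 0, 0, 0, 0, 0, 1], [0, 0, 0, 0, 0, 0, 1, 0], [0, 0, 0, 0, 0, 1, 0, 0], [0, 0, 0, 0, 1, 0, 0, 0],
  [0, 0, 0, 1, 0, 0, 0, 0], [0, 0, 1, 0, 0, 0, 0, 0], [0, 1, 0, 0, 0, 0, 0, 0], [1, 0, 0, 0, 0, 0, 0, 0],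
  [0, 0, 0, 0, 0, 0, 1, 1], [0, 0, 0, 0, 0, 1, 1, 0], [0, 0, 0, 0, 1, 1, 0, 0], [0, 0, 0, 1, 1, 0, 0, 0],
  [0, 0, 1, 1, 0, 0, 0, 0], [0, 1, 0, 1, 0, 0, 0, 0], [1, 0, 1, 0, 0, 0, 0, 0], [0, 0, 0, 0, 0, 1, 1, 1],
  [0, 0, 0, 0, 1, 1, 1, 0], [0, 0, 0, 1, 1, 1, 0, 0], [0, 0, 1, 1, 1, 0, 0, 0], [0, 1, 0, 1, 1, 0, 0, 0],
  [0, 1, 1, 1, 0, 0, 0, 0], [1, 0, 1, 1, 0, 0, 0, 0], [0, 0, 0, 0, 1, 1, 1, 1], [0, 0, 0, 1, 1, 1, 1, 0],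
  [0, 0, 1, 1, 1, 1, 0, 0], [0, 1, 0, 1, 1, 1, 0, 0], [0, 1, 1, 1, 1, 0, 0, 0], [1, 0, 1, 1, 1, 0, 0, 0],
  [1, 1, 1, 1, 0, 0, 0, 0], [0, 0, 0, 1, 1, 1, 1, 1], [0, 0, 1, 1, 1, 1, 1, 0], [0, 1, 0, 1, 1, 1, 1, 0],
  [0, 1, 1, 1, 1, 1, 0, 0], [0, 1, 1, 2, 1, 0, 0, 0], [1, 0, 1, 1, 1, 1, 0, 0], [1, 1, 1, 1, 1, 0, 0, 0],
  [0, 0, 1, 1, 1, 1, 1, 1], [0, 1, 0, 1, 1, 1, 1, 1], [0, 1, 1, 1, 1, 1, 1, 0], [0, 1, 1, 2, 1, 1, 0, 0],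
  [1, 0, 1, 1, 1, 1, 1, 0], [1, 1, 1, 1, 1, 1, 0, 0], [1, 1, 1, 2, 1, 0, 0, 0], [0, 1, 1, 1, 1, 1, 1, 1],
  [0, 1, 1, 2, 1, 1, 1, 0], [0, 1, 1, 2, 2, 1, 0, 0], [1, 0, 1, 1, 1, 1, 1, 1], [1, 1, 1, 1, 1, 1, 1, 0],
  [1, 1, 1, 2, 1, 1, 0, 0], [1, 1, 2, 2, 1, 0, 0, 0], [0, 1, 1, 2, 1, 1, 1, 1], [0, 1, 1, 2, 2, 1, 1, 0],
  [1, 1, 1, 1, 1, 1, 1, 1], [1, 1, 1, 2, 1, 1, 1, 0], [1, 1, 1, 2, 2, 1, 0, 0], [1, 1, 2, 2, 1, 1, 0, 0],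
  [0, 1, 1, 2, 2, 1, 1, 1], [0, 1, 1, 2, 2, 2, 1, 0], [1, 1, 1, 2, 1, 1, 1, 1], [1, 1, 1, 2, 2, 1, 1, 0],
  [1, 1, 2, 2, 1, 1, 1, 0], [1, 1, 2, 2, 2, 1, 0, 0], [0, 1, 1, 2, 2, 2, 1, 1], [1, 1, 1, 2, 2, 1, 1, 1],
  [1, 1, 1, 2, 2, 2, 1, 0], [1, 1, 2, 2, 1, 1, 1, 1], [1, 1, 2, 2, 2, 1, 1, 0], [1, 1, 2, 3, 2, 1, 0, 0],
  [0, 1, 1, 2, 2, 2, 2, 1], [1, 1, 1, 2, 2, 2, 1, 1], [1, 1, 2, 2, 2, 1, 1, 1], [1, 1, 2, 2, 2, 2, 1, 0],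
  [1, 1, 2, 3, 2, 1, 1, 0], [1, 2, 2, 3, 2, 1, 0, 0], [1, 1, 1, 2, 2, 2, 2, 1], [1, 1, 2, 2, 2, 2, 1, 1],
  [1, 1, 2, 3, 2, 1, 1, 1], [1, 1, 2, 3, 2, 2, 1, 0], [1, 2, 2, 3, 2, 1, 1, 0], [1, 1, 2, 2, 2, 2, 2, 1],
  [1, 1, 2, 3, 2, 2, 1, 1], [1, 1, 2, 3, 3, 2, 1, 0], [1, 2, 2, 3, 2, 1, 1, 1], [1, 2, 2, 3, 2, 2, 1, 0],
  [1, 1, 2, 3, 2, 2, 2, 1], [1, 1, 2, 3, 3, 2, 1, 1], [1, 2, 2, 3, 2, 2, 1, 1], [1, 2, 2, 3, 3, 2, 1, 0],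
  [1, 1, 2, 3, 3, 2, 2, 1], [1, 2, 2, 3, 2, 2, 2, 1], [1, 2, 2, 3, 3, 2, 1, 1], [1, 2, 2, 4, 3, 2, 1, 0],
  [1, 1, 2, 3, 3, 3, 2, 1], [1, 2, 2, 3, 3, 2, 2, 1], [1, 2, 2, 4, 3, 2, 1, 1], [1, 2, 3, 4, 3, 2, 1, 0],
  [1, 2, 2, 3, 3, 3, 2, 1], [1, 2, 2, 4, 3, 2, 2, 1], [1, 2, 3, 4, 3, 2, 1, 1], [2, 2, 3, 4, 3, 2, 1, 0],
  [1, 2, 2, 4, 3, 3, 2, 1], [1, 2, 3, 4, 3, 2, 2, 1], [2, 2, 3, 4, 3, 2, 1, 1], [1, 2, 2, 4, 4, 3, 2, 1],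
  [1, 2, 3, 4, 3, 3, 2, 1], [2, 2, 3, 4, 3, 2, 2, 1], [1, 2, 3, 4, 4, 3, 2, 1], [2, 2, 3, 4, 3, 3, 2, 1],
  [1, 2, 3, 5, 4, 3, 2, 1], [2, 2, 3, 4, 4, 3, 2, 1], [1, 3, 3, 5, 4, 3, 2, 1], [2, 2, 3, 5, 4, 3, 2, 1],
  [2, 2, 4, 5, 4, 3, 2, 1], [2, 3, 3, 5, 4, 3, 2, 1], [2, 3, 4, 5, 4, 3, 2, 1], [2, 3, 4, 6, 4, 3, 2, 1],
  [2, 3, 4, 6, 5, 3, 2, 1], [2, 3, 4, 6, 5, 4, 2, 1], [2, 3, 4, 6, 5, 4, 3, 1], [2, 3, 4, 6, 5, 4, 3, 2]]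

/-- The positive roots of `E₈`, as vectors. -/
def posRoot (n : Fin posRows.length) : Fin 8 → ℤ := fun i => ((posRows.get n).getD i 0 : ℕ)

theorem sum_posRows (f : List ℕ → ℕ) : ∑ n, f (posRows.get n) = (posRows.map f).sum :=
  Fin.sum_univ_fun_getElem posRows f

/-- An invariant symmetric 2-tensor is a multiple of the inverse form. Contracting with the Cartan
matrix fixes the factor: `120 * 2 = 30 * 8`. -/
theorem posRows_second_moment : ∀ i j : Fin 8,
    (posRows.map fun r => r.getD i 0 * r.getD j 0).sum = 30 * invCartanE8 i j := by
  decide +kernel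

/-- The design property in degree four: the moment is the symmetrized square of the inverse form. A
double contraction gives the factor, `120 * 4 = 6 * (64 + 8 + 8)`. The index restrictions only
shorten the computation. -/
theorem posRows_fourth_moment : ∀ i j : Fin 8, i ≤ j → ∀ k l : Fin 8, k ≤ l →
    (posRows.map fun r => (r.getD i 0 * r.getD j 0) * (r.getD k 0 * r.getD l 0)).sum =
      6 * (invCartanE8 i j * invCartanE8 k l + invCartanE8 i k * invCartanE8 j l +
        invCartanE8 i l * invCartanE8 j k) := by
  decide +kernel

theorem invCartanE8_symm : ∀ i j : Fin 8, invCartanE8 i j = invCartanE8 j i := by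
  have h : invCartanE8.transpose = invCartanE8 := by decide +kernel
  exact fun i j => congrFun (congrFun h j) i

theorem posRoot_second_moment (i j : Fin 8) :
    ∑ n, posRoot n i * posRoot n j = 30 * (invCartanE8 i j : ℤ) := by
  have h := posRows_second_moment i j
  rw [← sum_posRows] at h
  simp only [posRoot]
  exact_mod_cast h

theorem posRoot_fourth_moment (i j k l : Fin 8) :
    ∑ n, (posRoot n i * posRoot n j) * (posRoot n k * posRoot n l) =
      6 * ((invCartanE8 i j : ℤ) * invCartanE8 k l + (invCartanE8 i k : ℤ) * invCartanE8 j l +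
        (invCartanE8 i l : ℤ) * invCartanE8 j k) := by
  have key : ∀ i j : Fin 8, i ≤ j → ∀ k l : Fin 8, k ≤ l →
      ∑ n, (posRoot n i * posRoot n j) * (posRoot n k * posRoot n l) =
      6 * ((invCartanE8 i j : ℤ) * invCartanE8 k l + (invCartanE8 i k : ℤ) * invCartanE8 j l +
        (invCartanE8 i l : ℤ) * invCartanE8 j k) := fun i j hij k l hkl => by
    have h := posRows_fourth_moment i j hij k l hkl
    rw [← sum_posRows] at h
    simp only [posRoot]
    exact_mod_cast h
  have key' : ∀ i j : Fin 8, i ≤ j → ∀ k l : Fin 8,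
      ∑ n, (posRoot n i * posRoot n j) * (posRoot n k * posRoot n l) =
      6 * ((invCartanE8 i j : ℤ) * invCartanE8 k l + (invCartanE8 i k : ℤ) * invCartanE8 j l +
        (invCartanE8 i l : ℤ) * invCartanE8 j k) := fun i j hij k l => by
    rcases le_total k l with h | h
    · exact key i j hij k l h
    · have := key i j hij l k h
      simp only [mul_comm (posRoot _ l)] at this
      rw [this, invCartanE8_symm l k]; ring
  rcases le_total i j with h | h
  · exact key' i j h k l
  · have := key' j i h k l
    simp only [mul_comm (posRoot _ j)] at this
    rw [this, invCartanE8_symm j i]; ring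

/-- The inverse Cartan matrix of type `E₈` with integer entries. -/
abbrev invCartanE8Int : Matrix (Fin 8) (Fin 8) ℤ := invCartanE8.map (Nat.cast : ℕ → ℤ)

theorem invCartanE8Int_apply (i j : Fin 8) : invCartanE8Int i j = (invCartanE8 i j : ℤ) := rfl

theorem sum_posRoot_quadratic (M : Matrix (Fin 8) (Fin 8) ℤ) :
    ∑ n, posRoot n ⬝ᵥ M.mulVec (posRoot n) = 30 * (M * invCartanE8Int).trace := by
  have h : ∀ n, posRoot n ⬝ᵥ M.mulVec (posRoot n) =
      ∑ i, ∑ j, M i j * (posRoot n i * posRoot n j) := fun n => by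
    simp only [dotProduct, Matrix.mulVec, Finset.mul_sum]
    exact Finset.sum_congr rfl fun i _ => Finset.sum_congr rfl fun j _ => by ring
  simp only [h]
  rw [Finset.sum_comm, Matrix.trace, Finset.mul_sum]
  refine Finset.sum_congr rfl fun i _ => ?_
  rw [Finset.sum_comm, Matrix.diag_apply, Matrix.mul_apply, Finset.mul_sum]
  refine Finset.sum_congr rfl fun j _ => ?_
  rw [← Finset.mul_sum, posRoot_second_moment, invCartanE8Int_apply, invCartanE8_symm]
  ring

/-- The three traces are the contractions of `M ⊗ M` with the three pairings of four indices in the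
fourth moment. -/
theorem sum_posRoot_quadratic_sq (M : Matrix (Fin 8) (Fin 8) ℤ) :
    ∑ n, (posRoot n ⬝ᵥ M.mulVec (posRoot n)) ^ 2 =
      6 * ((M * invCartanE8Int).trace ^ 2 +
        (M * invCartanE8Int * (M.transpose * invCartanE8Int)).trace +
        (M * invCartanE8Int * (M * invCartanE8Int)).trace) := by
  have h : ∀ n, (posRoot n ⬝ᵥ M.mulVec (posRoot n)) ^ 2 =
      ∑ i, ∑ j, ∑ k, ∑ l, M i j * M k l *
        ((posRoot n i * posRoot n j) * (posRoot n k * posRoot n l)) := fun n => by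
    have h1 : posRoot n ⬝ᵥ M.mulVec (posRoot n) =
        ∑ i, ∑ j, M i j * (posRoot n i * posRoot n j) := by
      simp only [dotProduct, Matrix.mulVec, Finset.mul_sum]
      exact Finset.sum_congr rfl fun i _ => Finset.sum_congr rfl fun j _ => by ring
    rw [h1, sq]
    simp only [Finset.sum_mul, Finset.mul_sum]
    refine Finset.sum_congr rfl fun i _ => Finset.sum_congr rfl fun j _ =>
      Finset.sum_congr rfl fun k _ => Finset.sum_congr rfl fun l _ => by ring
  have t1 : (M * invCartanE8Int).trace ^ 2 = ∑ i, ∑ j, ∑ k, ∑ l, M i j * M k l *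
      ((invCartanE8 i j : ℤ) * invCartanE8 k l) := by
    rw [sq]
    simp only [Matrix.trace, Matrix.diag_apply, Matrix.mul_apply, Finset.sum_mul, Finset.mul_sum]
    refine Finset.sum_congr rfl fun i _ => Finset.sum_congr rfl fun j _ =>
      Finset.sum_congr rfl fun k _ => Finset.sum_congr rfl fun l _ => ?_
    rw [invCartanE8Int_apply, invCartanE8Int_apply, invCartanE8_symm j i, invCartanE8_symm l k]
    ring
  have t2 : (M * invCartanE8Int * (M.transpose * invCartanE8Int)).trace =
      ∑ i, ∑ j, ∑ k, ∑ l, M i j * M k l * ((invCartanE8 i k : ℤ) * invCartanE8 j l) := by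
    simp only [Matrix.trace, Matrix.diag_apply, Matrix.mul_apply, Finset.sum_mul, Finset.mul_sum]
    refine Finset.sum_congr rfl fun i _ => ?_
    rw [Finset.sum_comm, Finset.sum_congr rfl fun k _ => Finset.sum_comm, Finset.sum_comm]
    refine Finset.sum_congr rfl fun j _ => Finset.sum_congr rfl fun k _ =>
      Finset.sum_congr rfl fun l _ => ?_
    rw [invCartanE8Int_apply, invCartanE8Int_apply, invCartanE8_symm k i, Matrix.transpose_apply]
    ring
  have t3 : (M * invCartanE8Int * (M * invCartanE8Int)).trace =
      ∑ i, ∑ j, ∑ k, ∑ l, M i j * M k l * ((invCartanE8 i l : ℤ) * invCartanE8 j k) := by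
    simp only [Matrix.trace, Matrix.diag_apply, Matrix.mul_apply, Finset.sum_mul, Finset.mul_sum]
    refine Finset.sum_congr rfl fun i _ => ?_
    rw [Finset.sum_congr rfl fun k _ => Finset.sum_comm, Finset.sum_comm]
    refine Finset.sum_congr rfl fun j _ => Finset.sum_congr rfl fun k _ =>
      Finset.sum_congr rfl fun l _ => ?_
    rw [invCartanE8Int_apply, invCartanE8Int_apply, invCartanE8_symm l i]
    ring
  rw [t1, t2, t3]
  simp only [h, ← Finset.sum_add_distrib, Finset.mul_sum]
  rw [Finset.sum_comm]
  refine Finset.sum_congr rfl fun i _ => ?_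
  rw [Finset.sum_comm]
  refine Finset.sum_congr rfl fun j _ => ?_
  rw [Finset.sum_comm]
  refine Finset.sum_congr rfl fun k _ => ?_
  rw [Finset.sum_comm]
  refine Finset.sum_congr rfl fun l _ => ?_
  rw [← Finset.mul_sum, posRoot_fourth_moment]
  ring

/-! ### Traces of isometries as sums over roots -/

/-- The matrix of an isometry of `E₈` in the basis of simple roots. -/
def isometryMatrix (g : isometryGroup formE8) : Matrix (Fin 8) (Fin 8) ℤ :=
  LinearMap.toMatrix' (g.1 : (Fin 8 → ℤ) →ₗ[ℤ] (Fin 8 → ℤ))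

theorem isometryMatrix_mulVec (g : isometryGroup formE8) (x : Fin 8 → ℤ) :
    (isometryMatrix g).mulVec x = g.1 x := by
  rw [isometryMatrix, LinearMap.toMatrix'_mulVec]
  rfl

theorem isometryMatrix_one : isometryMatrix 1 = 1 :=
  LinearMap.toMatrix'_id

theorem isometryMatrix_mul (g k : isometryGroup formE8) :
    isometryMatrix (g * k) = isometryMatrix g * isometryMatrix k :=
  LinearMap.toMatrix'_comp _ _

theorem isometryMatrix_pow (g : isometryGroup formE8) (n : ℕ) :
    isometryMatrix (g ^ n) = isometryMatrix g ^ n := by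
  induction n with
  | zero => rw [pow_zero, pow_zero, isometryMatrix_one]
  | succ n ih => rw [pow_succ, pow_succ, isometryMatrix_mul, ih]

theorem isometryMatrix_transpose_mul (g : isometryGroup formE8) :
    (isometryMatrix g).transpose * CartanMatrix.E₈ * isometryMatrix g = CartanMatrix.E₈ := by
  ext i j
  have h := g.2 (Pi.single i 1) (Pi.single j 1)
  rw [← isometryMatrix_mulVec, ← isometryMatrix_mulVec, formE8_eq_dotProduct,
    formE8_eq_dotProduct] at h
  simp only [Matrix.mulVec_single_one, single_one_dotProduct, Matrix.mul_assoc] at h ⊢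
  exact h

theorem isometryMatrix_mul_inv_transpose (g : isometryGroup formE8) :
    isometryMatrix g * invCartanE8Int * (isometryMatrix g).transpose = invCartanE8Int := by
  have h := isometryMatrix_transpose_mul g
  set A := isometryMatrix g
  have h2 : (invCartanE8Int * A.transpose * CartanMatrix.E₈) * A = 1 := by
    rw [Matrix.mul_assoc, Matrix.mul_assoc, ← Matrix.mul_assoc A.transpose, h, inv_mul_cartan]
  have h3 : A * invCartanE8Int * A.transpose * CartanMatrix.E₈ = 1 := by
    have := mul_eq_one_comm.mp h2
    simpa only [Matrix.mul_assoc] using this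
  calc A * invCartanE8Int * A.transpose
      = A * invCartanE8Int * A.transpose * (CartanMatrix.E₈ * invCartanE8Int) := by
        rw [cartan_mul_inv, mul_one]
    _ = invCartanE8Int := by rw [← mul_assoc, h3, one_mul]

theorem formE8_self_apply (g : isometryGroup formE8) (x : Fin 8 → ℤ) :
    formE8 x (g.1 x) = x ⬝ᵥ (CartanMatrix.E₈ * isometryMatrix g).mulVec x := by
  rw [formE8_eq_dotProduct, ← Matrix.mulVec_mulVec, isometryMatrix_mulVec]

theorem sum_posRoot_form (g : isometryGroup formE8) :
    ∑ n, formE8 (posRoot n) (g.1 (posRoot n)) = 30 * (isometryMatrix g).trace := by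
  simp only [formE8_self_apply]
  rw [sum_posRoot_quadratic, Matrix.trace_mul_comm, ← mul_assoc, inv_mul_cartan, one_mul]

/-- Take `M` to be the Cartan matrix times the matrix of `g`. The pairing that involves the
transpose contracts to the identity because `g` preserves the form, which gives the `8`. -/
theorem sum_posRoot_form_sq (g : isometryGroup formE8) :
    ∑ n, formE8 (posRoot n) (g.1 (posRoot n)) ^ 2 =
      6 * ((isometryMatrix g).trace ^ 2 + 8 + (isometryMatrix g ^ 2).trace) := by
  simp only [formE8_self_apply]
  rw [sum_posRoot_quadratic_sq]
  have hinv := isometryMatrix_mul_inv_transpose g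
  set A := isometryMatrix g
  have e1 : (CartanMatrix.E₈ * A * invCartanE8Int).trace = A.trace := by
    rw [Matrix.trace_mul_comm, ← mul_assoc, inv_mul_cartan, one_mul]
  have e2 : CartanMatrix.E₈ * A * invCartanE8Int *
      ((CartanMatrix.E₈ * A).transpose * invCartanE8Int) = 1 := by
    rw [Matrix.transpose_mul, CartanMatrix.E₈_transpose]
    calc _ = CartanMatrix.E₈ * (A * invCartanE8Int * A.transpose) *
        (CartanMatrix.E₈ * invCartanE8Int) := by simp only [mul_assoc]
      _ = 1 := by rw [hinv, cartan_mul_inv, mul_one]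
  have e3 : (CartanMatrix.E₈ * A * invCartanE8Int * (CartanMatrix.E₈ * A * invCartanE8Int)).trace =
      (A ^ 2).trace := by
    have : CartanMatrix.E₈ * A * invCartanE8Int * (CartanMatrix.E₈ * A * invCartanE8Int) =
        CartanMatrix.E₈ * A ^ 2 * invCartanE8Int := by
      calc _ = CartanMatrix.E₈ * A * (invCartanE8Int * CartanMatrix.E₈) * A * invCartanE8Int := by
            simp only [mul_assoc]
        _ = _ := by rw [inv_mul_cartan, mul_one, sq, mul_assoc _ A A]
    rw [this, Matrix.trace_mul_comm, ← mul_assoc, inv_mul_cartan, one_mul]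
  rw [e1, e2, e3, Matrix.trace_one]
  rfl

/-- Modulo `p` the trace of a `p`-th power is the `p`-th power of the trace, and Fermat's little
theorem removes that power. -/
theorem trace_pow_prime_modEq (A : Matrix (Fin 8) (Fin 8) ℤ) (p : ℕ) [Fact p.Prime] :
    (p : ℤ) ∣ (A ^ p).trace - A.trace := by
  rw [← ZMod.intCast_eq_intCast_iff_dvd_sub]
  have h := ZMod.trace_pow_card (A.map (Int.castRingHom (ZMod p)))
  rw [ZMod.pow_card, ← Matrix.map_pow, ← AddMonoidHom.map_trace, ← AddMonoidHom.map_trace] at h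
  exact h.symm

/-! ### Inner products within the orbit of a root -/

theorem formE8_eq_two {x y : Fin 8 → ℤ} (hx : formE8 x x = 2) (hy : formE8 y y = 2)
    (h : formE8 x y = 2) : y = x := by
  have : formE8 (y - x) (y - x) = 0 := by
    simp only [map_sub, LinearMap.sub_apply, hx, hy, h, formE8_comm y x]; norm_num
  exact sub_eq_zero.mp (formE8_self_eq_zero this)

theorem formE8_eq_neg_two {x y : Fin 8 → ℤ} (hx : formE8 x x = 2) (hy : formE8 y y = 2)
    (h : formE8 x y = -2) : y = -x := by
  have : formE8 (y + x) (y + x) = 0 := by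
    simp only [map_add, LinearMap.add_apply, hx, hy, h, formE8_comm y x]; norm_num
  exact eq_neg_of_add_eq_zero_left (formE8_self_eq_zero this)

theorem formE8_bounds {x y : Fin 8 → ℤ} (hx : formE8 x x = 2) (hy : formE8 y y = 2) :
    -2 ≤ formE8 x y ∧ formE8 x y ≤ 2 := by
  have h1 := formE8_self_nonneg (y - x)
  have h2 := formE8_self_nonneg (y + x)
  simp only [map_sub, LinearMap.sub_apply, hx, hy, formE8_comm y x, map_add,
    LinearMap.add_apply] at h1 h2
  constructor <;> linarith

/-- The norm of `h r - r` is `4 - 2 (r, hr)`, which would be `2`. -/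
theorem IsRootless.form_ne_one {h : isometryGroup formE8} (hr : IsRootless h) {r : Fin 8 → ℤ}
    (h2 : formE8 r r = 2) : formE8 r (h.1 r) ≠ 1 := fun h1 => by
  apply hr r
  simp only [map_sub, LinearMap.sub_apply, h2, h1, formE8_comm (h.1 r) r, h.2 r r]
  norm_num

theorem coe_pow_apply (h : isometryGroup formE8) (n : ℕ) (x : Fin 8 → ℤ) :
    (h ^ (n + 1)).1 x = h.1 ((h ^ n).1 x) := by
  rw [pow_succ']; rfl

/-- Since `h² - 1 = (h - 1)(h + 1)`, its image lies in that of `h - 1`. -/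
theorem IsRootless.sq {h : isometryGroup formE8} (hr : IsRootless h) : IsRootless (h ^ 2) := by
  intro x
  have : (h ^ 2).1 x - x = h.1 (h.1 x + x) - (h.1 x + x) := by
    rw [coe_pow_apply, pow_one, map_add]; abel
  rw [this]
  exact hr _

theorem IsRootless.cube {h : isometryGroup formE8} (hr : IsRootless h) : IsRootless (h ^ 3) := by
  intro x
  have : (h ^ 3).1 x - x = h.1 (h.1 (h.1 x) + h.1 x + x) - (h.1 (h.1 x) + h.1 x + x) := by
    rw [coe_pow_apply, coe_pow_apply, pow_one, map_add, map_add]; abel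
  rw [this]
  exact hr _

theorem cases_of_bounds {p : ℤ} (h : -2 ≤ p ∧ p ≤ 2) (h1 : p ≠ 1) :
    p = 2 ∨ p = 0 ∨ p = -1 ∨ p = -2 := by omega

/-- The inner products in the `h`-orbit of a root, for a rootless isometry `h` with `h ^ 6 = 1`. -/
theorem IsRootless.orbit_type {h : isometryGroup formE8} (hr : IsRootless h) (h6 : h ^ 6 = 1)
    {r : Fin 8 → ℤ} (h2 : formE8 r r = 2) :
    (formE8 r ((h ^ 2).1 r) = 2 ∧ (h ^ 2).1 r = r ∧
      formE8 r (h.1 r) ∈ ({2, 0, -1, -2} : Set ℤ)) ∨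
    (formE8 r ((h ^ 2).1 r) = -1 ∧ formE8 r (h.1 r) = -1 ∧ formE8 r ((h ^ 3).1 r) = 2) ∨
    (formE8 r ((h ^ 2).1 r) = -1 ∧ formE8 r (h.1 r) = 0) ∨
    (formE8 r ((h ^ 2).1 r) = 0 ∧ formE8 r (h.1 r) = 0) ∨
    (formE8 r ((h ^ 2).1 r) = 0 ∧ formE8 r (h.1 r) = -1 ∧ formE8 r ((h ^ 3).1 r) = 0 ∧
      r + h.1 r + (h ^ 2).1 r + (h ^ 3).1 r + (h ^ 4).1 r + (h ^ 5).1 r = 0) := by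
  have n1 := hr.form_ne_one h2
  have n2 := hr.sq.form_ne_one h2
  have n3 := hr.cube.form_ne_one h2
  have e2 : (h ^ 2).1 r = h.1 (h.1 r) := by rw [coe_pow_apply, pow_one]
  have e3 : (h ^ 3).1 r = h.1 (h.1 (h.1 r)) := by rw [coe_pow_apply, e2]
  have e4 : (h ^ 4).1 r = h.1 (h.1 (h.1 (h.1 r))) := by rw [coe_pow_apply, e3]
  have e5 : (h ^ 5).1 r = h.1 (h.1 (h.1 (h.1 (h.1 r)))) := by rw [coe_pow_apply, e4]
  have e6 : h.1 (h.1 (h.1 (h.1 (h.1 (h.1 r))))) = r := by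
    rw [← e5, ← coe_pow_apply, h6]; rfl
  have b1 := formE8_bounds h2 ((h.2 r r).trans h2)
  have b2 := formE8_bounds h2 (((h ^ 2).2 r r).trans h2)
  have b3 := formE8_bounds h2 (((h ^ 3).2 r r).trans h2)
  have m1 := fun e => formE8_eq_two h2 ((h.2 r r).trans h2) e
  have m1' := fun e => formE8_eq_neg_two h2 ((h.2 r r).trans h2) e
  have m2 := fun e => formE8_eq_two h2 (((h ^ 2).2 r r).trans h2) e
  have m2' := fun e => formE8_eq_neg_two h2 (((h ^ 2).2 r r).trans h2) e
  rw [e2] at n2 b2 m2 m2' ⊢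
  rw [e3] at n3 b3 ⊢
  rw [e4, e5]
  clear e2 e3 e4 e5
  set r1 := h.1 r with hr1
  set r2 := h.1 r1 with hr2
  set r3 := h.1 r2 with hr3
  set r4 := h.1 r3 with hr4
  set r5 := h.1 r4 with hr5
  set p1 := formE8 r r1 with hp1
  set p2 := formE8 r r2 with hp2
  set p3 := formE8 r r3 with hp3
  have f11 : formE8 r1 r1 = 2 := by rw [hr1, h.2, h2]
  have f22 : formE8 r2 r2 = 2 := by rw [hr2, h.2, f11]
  have f33 : formE8 r3 r3 = 2 := by rw [hr3, h.2, f22]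
  have f44 : formE8 r4 r4 = 2 := by rw [hr4, h.2, f33]
  have f55 : formE8 r5 r5 = 2 := by rw [hr5, h.2, f44]
  have f12 : formE8 r1 r2 = p1 := by rw [hr2, hr1, h.2]
  have f23 : formE8 r2 r3 = p1 := by rw [hr3, hr2, h.2, f12]
  have f34 : formE8 r3 r4 = p1 := by rw [hr4, hr3, h.2, f23]
  have f45 : formE8 r4 r5 = p1 := by rw [hr5, hr4, h.2, f34]
  have f05 : formE8 r r5 = p1 := by rw [← f45, ← h.2 r4 r5, e6, ← hr5, formE8_comm]
  have f13 : formE8 r1 r3 = p2 := by rw [hr3, hr1, h.2]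
  have f24 : formE8 r2 r4 = p2 := by rw [hr4, hr2, h.2, f13]
  have f35 : formE8 r3 r5 = p2 := by rw [hr5, hr3, h.2, f24]
  have f04 : formE8 r r4 = p2 := by
    rw [formE8_comm, ← f35, ← h.2 r3 r5, e6, ← hr4]
  have f15 : formE8 r1 r5 = p2 := by rw [hr5, hr1, h.2, f04]
  have f14 : formE8 r1 r4 = p3 := by rw [hr4, hr1, h.2]
  have f25 : formE8 r2 r5 = p3 := by rw [hr5, hr2, h.2, f14]
  have g10 := formE8_comm r1 r
  have g20 := formE8_comm r2 r
  have g30 := formE8_comm r3 r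
  have g40 := formE8_comm r4 r
  have g50 := formE8_comm r5 r
  have g21 := formE8_comm r2 r1
  have g31 := formE8_comm r3 r1
  have g41 := formE8_comm r4 r1
  have g51 := formE8_comm r5 r1
  have g32 := formE8_comm r3 r2
  have g42 := formE8_comm r4 r2
  have g52 := formE8_comm r5 r2
  have g43 := formE8_comm r4 r3
  have g53 := formE8_comm r5 r3
  have g54 := formE8_comm r5 r4
  have k1 : formE8 (r + r1 + r2 + r3 + r4 + r5) (r + r1 + r2 + r3 + r4 + r5) =
      6 * (2 + 2 * p1 + 2 * p2 + p3) := by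
    simp only [map_add, LinearMap.add_apply]; linarith
  have k2 : formE8 (r + r2 + r4) (r + r2 + r4) = 3 * (2 + 2 * p2) := by
    simp only [map_add, LinearMap.add_apply]; linarith
  have k3 : formE8 r1 (r + r2 + r4) = 2 * p1 + p3 := by
    simp only [map_add]; linarith
  -- This vector serves only to bound `p3` from above when `p2 = 0` and `p1 = -1`. The orbit sum
  -- `k1` bounds `p3` below by `0`, and `p3 ≠ 1` then forces `p3 = 0`.
  have k4 : formE8 (r4 + r3 - r1 - r) (r4 + r3 - r1 - r) = 8 + 4 * p1 - 4 * p2 - 4 * p3 := by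
    simp only [map_add, map_sub, LinearMap.add_apply, LinearMap.sub_apply]; linarith
  have s1 := formE8_self_nonneg (r + r1 + r2 + r3 + r4 + r5)
  have s4 := formE8_self_nonneg (r4 + r3 - r1 - r)
  have q1 : p1 = 2 ∨ p1 = 0 ∨ p1 = -1 ∨ p1 = -2 := cases_of_bounds b1 n1
  have q2 : p2 = 2 ∨ p2 = 0 ∨ p2 = -1 ∨ p2 = -2 := cases_of_bounds b2 n2
  rcases q2 with q2 | q2 | q2 | q2
  · exact Or.inl ⟨q2, m2 q2, by simpa using q1⟩
  · have c1 : p1 ≠ 2 := fun e => by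
      have : r2 = r := by rw [hr2, m1 e, ← hr1, m1 e]
      rw [hp2, this, h2] at q2; exact absurd q2 (by norm_num)
    have c2 : p1 ≠ -2 := fun e => by
      have : r2 = r := by rw [hr2, m1' e, map_neg, ← hr1, m1' e, neg_neg]
      rw [hp2, this, h2] at q2; exact absurd q2 (by norm_num)
    rcases q1 with q1 | q1 | q1 | q1
    · exact absurd q1 c1
    · exact Or.inr (Or.inr (Or.inr (Or.inl ⟨q2, q1⟩)))
    · have q3 : p3 = 0 := by
        rw [k1, q1, q2] at s1
        rw [k4, q1, q2] at s4
        clear_value p3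
        clear * - s1 s4 n3
        omega
      refine Or.inr (Or.inr (Or.inr (Or.inr ⟨q2, q1, q3, formE8_self_eq_zero ?_⟩)))
      rw [k1, q1, q2, q3]; norm_num
    · exact absurd q1 c2
  · have z : r + r2 + r4 = 0 := formE8_self_eq_zero (by rw [k2, q2]; norm_num)
    rw [z, map_zero] at k3
    have : (p1 = -1 ∧ p3 = 2) ∨ p1 = 0 := by
      clear_value p1 p3
      clear * - k3 q1 b3
      omega
    rcases this with ⟨c, d⟩ | c
    · exact Or.inr (Or.inl ⟨q2, c, d⟩)
    · exact Or.inr (Or.inr (Or.inl ⟨q2, c⟩))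
  · exfalso
    have c := m2' q2
    have : r = -r := by
      calc r = h.1 r5 := e6.symm
        _ = -r := by
          rw [hr5, hr4, hr3, c, map_neg, map_neg, ← hr1, ← hr2, c, map_neg, map_neg, map_neg,
            map_neg, ← hr1, ← hr2, c]
          simp
    have r0 : r = 0 := by
      funext i
      have := congrFun this i
      simp at this ⊢
      omega
    rw [r0] at h2
    simp at h2

theorem posRoot_norm (n : Fin posRows.length) : formE8 (posRoot n) (posRoot n) = 2 := by
  have h : ∀ r ∈ posRows, ((r.getD 0 0 : ℤ) * (2 * r.getD 0 0 - r.getD 2 0) +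
      r.getD 1 0 * (2 * r.getD 1 0 - r.getD 3 0) +
      r.getD 2 0 * (2 * r.getD 2 0 - r.getD 0 0 - r.getD 3 0) +
      r.getD 3 0 * (2 * r.getD 3 0 - r.getD 1 0 - r.getD 2 0 - r.getD 4 0) +
      r.getD 4 0 * (2 * r.getD 4 0 - r.getD 3 0 - r.getD 5 0) +
      r.getD 5 0 * (2 * r.getD 5 0 - r.getD 4 0 - r.getD 6 0) +
      r.getD 6 0 * (2 * r.getD 6 0 - r.getD 5 0 - r.getD 7 0) +
      r.getD 7 0 * (2 * r.getD 7 0 - r.getD 6 0)) = 2 := by decide +kernel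
  rw [formE8_apply]
  exact h _ (List.get_mem _ _)

theorem exists_posRoot_eq_simple : ∀ i : Fin 8, ∃ n, posRoot n = Pi.single i 1 := by
  decide +kernel

theorem isometry_eq_one {g : isometryGroup formE8} (h : ∀ n, g.1 (posRoot n) = posRoot n) :
    g = 1 := by
  apply Subtype.ext
  apply LinearEquiv.toLinearMap_injective
  refine (Pi.basisFun ℤ (Fin 8)).ext fun i => ?_
  obtain ⟨n, hn⟩ := exists_posRoot_eq_simple i
  rw [Pi.basisFun_apply, ← hn]
  exact h n

/-! ### Counting roots by inner product with their image -/

/-- The number of positive roots with a given property, as an integer. -/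
noncomputable def posCount (p : Fin posRows.length → Prop) : ℤ :=
  open Classical in ∑ n, if p n then 1 else 0

theorem posCount_nonneg (p : Fin posRows.length → Prop) : 0 ≤ posCount p :=
  Finset.sum_nonneg fun n _ => by split_ifs <;> norm_num

theorem sum_one_posRoot : ∑ _n : Fin posRows.length, (1 : ℤ) = 120 := by
  rw [Finset.sum_const, Finset.card_univ, Fintype.card_fin]
  rfl

theorem posCount_add_le {p q s : Fin posRows.length → Prop} (hp : ∀ n, p n → s n)
    (hq : ∀ n, q n → s n) (hpq : ∀ n, p n → ¬ q n) : posCount p + posCount q ≤ posCount s := by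
  classical
  rw [posCount, posCount, posCount, ← Finset.sum_add_distrib]
  refine Finset.sum_le_sum fun n _ => ?_
  have := hp n
  have := hq n
  have := hpq n
  split_ifs <;> simp_all

theorem of_posCount_le {p q : Fin posRows.length → Prop} (h : ∀ n, p n → q n)
    (hc : posCount q ≤ posCount p) (n) (hq : q n) : p n := by
  classical
  by_contra hp
  refine absurd hc (not_le.mpr (Finset.sum_lt_sum (fun m _ => ?_) ⟨n, Finset.mem_univ n, ?_⟩))
  · have := h m
    split_ifs <;> simp_all
  · simp [hp, hq]

theorem posCount_true : posCount (fun _ => True) = 120 := by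
  simp only [posCount, if_true]
  exact sum_one_posRoot

/-- Counting the values of `(r, gr)` for an isometry for which they avoid `1`. -/
theorem IsRootless.count {g : isometryGroup formE8} (hr : IsRootless g) :
    posCount (fun n => formE8 (posRoot n) (g.1 (posRoot n)) = 2) +
      posCount (fun n => formE8 (posRoot n) (g.1 (posRoot n)) = 0) +
      posCount (fun n => formE8 (posRoot n) (g.1 (posRoot n)) = -1) +
      posCount (fun n => formE8 (posRoot n) (g.1 (posRoot n)) = -2) = 120 ∧
    2 * posCount (fun n => formE8 (posRoot n) (g.1 (posRoot n)) = 2) -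
      posCount (fun n => formE8 (posRoot n) (g.1 (posRoot n)) = -1) -
      2 * posCount (fun n => formE8 (posRoot n) (g.1 (posRoot n)) = -2) =
        30 * (isometryMatrix g).trace ∧
    4 * posCount (fun n => formE8 (posRoot n) (g.1 (posRoot n)) = 2) +
      posCount (fun n => formE8 (posRoot n) (g.1 (posRoot n)) = -1) +
      4 * posCount (fun n => formE8 (posRoot n) (g.1 (posRoot n)) = -2) =
        6 * ((isometryMatrix g).trace ^ 2 + 8 + (isometryMatrix g ^ 2).trace) := by
  have hv : ∀ n, formE8 (posRoot n) (g.1 (posRoot n)) = 2 ∨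
      formE8 (posRoot n) (g.1 (posRoot n)) = 0 ∨ formE8 (posRoot n) (g.1 (posRoot n)) = -1 ∨
      formE8 (posRoot n) (g.1 (posRoot n)) = -2 := fun n =>
    cases_of_bounds (formE8_bounds (posRoot_norm n) ((g.2 _ _).trans (posRoot_norm n)))
      (hr.form_ne_one (posRoot_norm n))
  rw [← sum_posRoot_form, ← sum_posRoot_form_sq, ← sum_one_posRoot]
  simp only [posCount, Finset.mul_sum, ← Finset.sum_add_distrib, ← Finset.sum_sub_distrib]
  refine ⟨?_, ?_, ?_⟩ <;> refine Finset.sum_congr rfl fun n _ => ?_ <;>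
    rcases hv n with e | e | e | e <;> simp [e]

theorem posCount_eq_zero {p : Fin posRows.length → Prop} (h : ∀ n, ¬ p n) : posCount p = 0 := by
  simp [posCount, h]

/-- The inverse of an isometry is its adjoint, hence is similar to the transpose. -/
theorem trace_isometryMatrix_inv (g : isometryGroup formE8) :
    (isometryMatrix g⁻¹).trace = (isometryMatrix g).trace := by
  have h1 : isometryMatrix g⁻¹ * isometryMatrix g = 1 := by
    rw [← isometryMatrix_mul, inv_mul_cancel, isometryMatrix_one]
  have h2 := isometryMatrix_mul_inv_transpose g
  have h3 : invCartanE8Int * (isometryMatrix g).transpose =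
      isometryMatrix g⁻¹ * invCartanE8Int := by
    rw [← h2, ← mul_assoc, ← mul_assoc, h1, one_mul, h2]
  have h4 : isometryMatrix g⁻¹ =
      invCartanE8Int * (isometryMatrix g).transpose * CartanMatrix.E₈ := by
    rw [h3, mul_assoc, inv_mul_cartan, mul_one]
  rw [h4, Matrix.trace_mul_comm, ← mul_assoc, cartan_mul_inv, one_mul, Matrix.trace_transpose]

/-- A rootless isometry of order `6` of `E₈` has a root whose orbit is the set of vertices of an
extended Dynkin diagram of type `A₅`. -/
theorem IsRootless.exists_orbit_A5 {h : isometryGroup formE8} (hr : IsRootless h)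
    (hord : orderOf h = 6) :
    ∃ r, formE8 r r = 2 ∧ formE8 r (h.1 r) = -1 ∧ formE8 r ((h ^ 2).1 r) = 0 ∧
      formE8 r ((h ^ 3).1 r) = 0 ∧
      r + h.1 r + (h ^ 2).1 r + (h ^ 3).1 r + (h ^ 4).1 r + (h ^ 5).1 r = 0 := by
  have h6 : h ^ 6 = 1 := hord ▸ pow_orderOf_eq_one h
  have hne2 : h ^ 2 ≠ 1 := fun e => by
    have := orderOf_dvd_of_pow_eq_one e; rw [hord] at this; omega
  have hne3 : h ^ 3 ≠ 1 := fun e => by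
    have := orderOf_dvd_of_pow_eq_one e; rw [hord] at this; omega
  by_contra hcon
  have ty := fun n => hr.orbit_type h6 (posRoot_norm n)
  have no : ∀ n, ¬ (formE8 (posRoot n) ((h ^ 2).1 (posRoot n)) = 0 ∧
      formE8 (posRoot n) (h.1 (posRoot n)) = -1) := fun n ⟨e1, e2⟩ => by
    rcases ty n with t | t | t | t | t
    · omega
    · omega
    · omega
    · omega
    · exact hcon ⟨posRoot n, posRoot_norm n, t.2.1, t.1, t.2.2.1, t.2.2.2⟩
  have eq3 : ∀ n, formE8 (posRoot n) ((h ^ 3).1 (posRoot n)) = 2 →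
      (h ^ 3).1 (posRoot n) = posRoot n := fun n e =>
    formE8_eq_two (posRoot_norm n) (((h ^ 3).2 _ _).trans (posRoot_norm n)) e
  have c11 : ∀ n, formE8 (posRoot n) (h.1 (posRoot n)) = 2 →
      formE8 (posRoot n) ((h ^ 2).1 (posRoot n)) = 2 := fun n e => by
    have := ty n; omega
  have c12 : ∀ n, formE8 (posRoot n) (h.1 (posRoot n)) = -2 →
      formE8 (posRoot n) ((h ^ 2).1 (posRoot n)) = 2 := fun n e => by
    have := ty n; omega
  have c13 : ∀ n, formE8 (posRoot n) (h.1 (posRoot n)) = -1 →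
      formE8 (posRoot n) ((h ^ 2).1 (posRoot n)) ≠ 2 →
      formE8 (posRoot n) ((h ^ 3).1 (posRoot n)) = 2 := fun n e e' => by
    have := ty n; have := no n; omega
  have c14 : ∀ n, formE8 (posRoot n) (h.1 (posRoot n)) = 2 →
      formE8 (posRoot n) ((h ^ 3).1 (posRoot n)) = 2 := fun n e => by
    have e1 := formE8_eq_two (posRoot_norm n) ((h.2 _ _).trans (posRoot_norm n)) e
    rw [coe_pow_apply, coe_pow_apply, pow_one, e1, e1, e1, posRoot_norm]
  have z2 := posCount_eq_zero
    (p := fun n => formE8 (posRoot n) ((h ^ 2).1 (posRoot n)) = -2) fun n e => by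
      have := ty n; omega
  obtain ⟨p1, p2, p3⟩ := hr.count
  obtain ⟨q1, q2, q3⟩ := hr.sq.count
  obtain ⟨s1, s2, s3⟩ := hr.cube.count
  have t4 : isometryMatrix (h ^ 2) ^ 2 = isometryMatrix (h ^ 2)⁻¹ := by
    rw [← isometryMatrix_pow, ← pow_mul, eq_inv_of_mul_eq_one_left (a := h ^ (2 * 2)) (b := h ^ 2)]
    rw [← pow_add, h6]
  have t6 : isometryMatrix (h ^ 3) ^ 2 = 1 := by
    rw [← isometryMatrix_pow, ← pow_mul, h6, isometryMatrix_one]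
  have u1 := trace_pow_prime_modEq (isometryMatrix h) 2
  have u2 := trace_pow_prime_modEq (isometryMatrix h) 3
  have u3 := trace_pow_prime_modEq (isometryMatrix (h ^ 2)) 3
  have u4 := trace_pow_prime_modEq (isometryMatrix (h ^ 3)) 2
  have t7 : isometryMatrix (h ^ 2) ^ 3 = 1 := by
    rw [← isometryMatrix_pow, ← pow_mul, h6, isometryMatrix_one]
  rw [t4, trace_isometryMatrix_inv, z2] at q3
  rw [z2] at q1 q2
  rw [t6, Matrix.trace_one, Fintype.card_fin] at s3 u4
  rw [t7, Matrix.trace_one, Fintype.card_fin] at u3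
  rw [← isometryMatrix_pow] at u1 u2 p3
  generalize (isometryMatrix h).trace = T1 at *
  generalize (isometryMatrix (h ^ 2)).trace = T2 at *
  generalize (isometryMatrix (h ^ 3)).trace = T3 at *
  have m1 := posCount_add_le c11 c12 (fun n e => by omega)
  have m2 := posCount_nonneg (fun n => formE8 (posRoot n) (h.1 (posRoot n)) = 2)
  have m3 := posCount_nonneg (fun n => formE8 (posRoot n) (h.1 (posRoot n)) = -2)
  have m4 := posCount_nonneg (fun n => formE8 (posRoot n) (h.1 (posRoot n)) = -1)
  have m5 := posCount_nonneg (fun n => formE8 (posRoot n) (h.1 (posRoot n)) = 0)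
  have n2 := posCount_nonneg (fun n => formE8 (posRoot n) ((h ^ 2).1 (posRoot n)) = 2)
  have n4 := posCount_nonneg (fun n => formE8 (posRoot n) ((h ^ 2).1 (posRoot n)) = -1)
  have n5 := posCount_nonneg (fun n => formE8 (posRoot n) ((h ^ 2).1 (posRoot n)) = 0)
  have o2 := posCount_nonneg (fun n => formE8 (posRoot n) ((h ^ 3).1 (posRoot n)) = 2)
  have o3 := posCount_nonneg (fun n => formE8 (posRoot n) ((h ^ 3).1 (posRoot n)) = -2)
  have o4 := posCount_nonneg (fun n => formE8 (posRoot n) ((h ^ 3).1 (posRoot n)) = -1)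
  have o5 := posCount_nonneg (fun n => formE8 (posRoot n) ((h ^ 3).1 (posRoot n)) = 0)
  have all2 : posCount (fun n => formE8 (posRoot n) ((h ^ 2).1 (posRoot n)) = 2) ≠ 120 := fun e =>
    hne2 <| isometry_eq_one fun n =>
      formE8_eq_two (posRoot_norm n) (((h ^ 2).2 _ _).trans (posRoot_norm n))
        (of_posCount_le (q := fun _ => True) (fun _ _ => trivial)
          (posCount_true.trans e.symm).le n trivial)
  have all3 : posCount (fun n => formE8 (posRoot n) ((h ^ 3).1 (posRoot n)) = 2) ≠ 120 := fun e =>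
    hne3 <| isometry_eq_one fun n => eq3 n
        (of_posCount_le (q := fun _ => True) (fun _ _ => trivial)
          (posCount_true.trans e.symm).le n trivial)
  -- If `h` fixes every positive root that `h²` fixes, then `(r, hr) = -1` excludes `h² r = r`. With
  -- the `A₅` pattern absent, only the orbit type with `h³ r = r` remains.
  have hcount3 : posCount (fun n => formE8 (posRoot n) ((h ^ 2).1 (posRoot n)) = 2) ≤
      posCount (fun n => formE8 (posRoot n) (h.1 (posRoot n)) = 2) →
      posCount (fun n => formE8 (posRoot n) (h.1 (posRoot n)) = 2) +
      posCount (fun n => formE8 (posRoot n) (h.1 (posRoot n)) = -1) ≤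
      posCount (fun n => formE8 (posRoot n) ((h ^ 3).1 (posRoot n)) = 2) := fun e => by
    refine posCount_add_le c14 (fun n en => c13 n en fun en' => ?_) (fun n e => by omega)
    have := of_posCount_le c11 e n en'
    omega
  -- Without the `A₅` pattern, `(r, hr) = -1` is incompatible with `(r, h²r) = 0`.
  have hcount1 : posCount (fun n => formE8 (posRoot n) (h.1 (posRoot n)) = -1) ≤
      posCount (fun n => formE8 (posRoot n) ((h ^ 2).1 (posRoot n)) = 2) +
      posCount (fun n => formE8 (posRoot n) ((h ^ 2).1 (posRoot n)) = -1) := by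
    have e1 := posCount_add_le (s := fun n => formE8 (posRoot n) (h.1 (posRoot n)) ≠ -1)
      (p := fun n => formE8 (posRoot n) ((h ^ 2).1 (posRoot n)) = 0) (q := fun _ => False)
      (fun n e e' => no n ⟨e, e'⟩) (fun _ e => e.elim) (fun _ _ e => e)
    have e2 := posCount_add_le (s := fun _ => True)
      (p := fun n => formE8 (posRoot n) (h.1 (posRoot n)) ≠ -1)
      (q := fun n => formE8 (posRoot n) (h.1 (posRoot n)) = -1)
      (fun _ _ => trivial) (fun _ _ => trivial) (fun _ e e' => e e')
    have e3 := posCount_nonneg (fun _ => False)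
    rw [posCount_true] at e2
    linarith
  clear c11 c12 c13 c14 no ty eq3 hcon z2 t4 t6 t7 hne2 hne3 h6 hord
  generalize posCount (fun n => formE8 (posRoot n) (h.1 (posRoot n)) = 2) = P2 at *
  generalize posCount (fun n => formE8 (posRoot n) (h.1 (posRoot n)) = 0) = P0 at *
  generalize posCount (fun n => formE8 (posRoot n) (h.1 (posRoot n)) = -1) = Pm1 at *
  generalize posCount (fun n => formE8 (posRoot n) (h.1 (posRoot n)) = -2) = Pm2 at *
  generalize posCount (fun n => formE8 (posRoot n) ((h ^ 2).1 (posRoot n)) = 2) = Q2 at *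
  generalize posCount (fun n => formE8 (posRoot n) ((h ^ 2).1 (posRoot n)) = 0) = Q0 at *
  generalize posCount (fun n => formE8 (posRoot n) ((h ^ 2).1 (posRoot n)) = -1) = Qm1 at *
  generalize posCount (fun n => formE8 (posRoot n) ((h ^ 3).1 (posRoot n)) = 2) = S2 at *
  generalize posCount (fun n => formE8 (posRoot n) ((h ^ 3).1 (posRoot n)) = 0) = S0 at *
  generalize posCount (fun n => formE8 (posRoot n) ((h ^ 3).1 (posRoot n)) = -1) = Sm1 at *
  generalize posCount (fun n => formE8 (posRoot n) ((h ^ 3).1 (posRoot n)) = -2) = Sm2 at *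
  clear hr h
  push_cast at u1 u2 u3 u4 s3
  -- As `h²` has order three, `tr h⁴ = tr h²` and `T2 ≡ 8` mod `3`. The counts give `Q2 = (T2 +
  -- 2)(T2 + 4)`; the values `2` and `5` make `Qm1` negative, and `8` makes `h²` trivial.
  have hT2 : T2 = -4 ∨ T2 = -1 := by
    have l : -4 ≤ T2 := by nlinarith
    have u : T2 ≤ 8 := by nlinarith
    have : T2 = -4 ∨ T2 = -1 ∨ T2 = 2 ∨ T2 = 5 ∨ T2 = 8 := by omega
    rcases this with rfl | rfl | rfl | rfl | rfl <;> omega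
  rcases hT2 with rfl | rfl
  -- No root is fixed by `h²`. Parity excludes `T1 = -1`; for `T1 = -4` every positive root has `(r,
  -- hr) = -1`, so `hcount3` makes `h³` trivial.
  · have hQ2 : Q2 = 0 := by omega
    have hT : (T1 + 1) * (T1 + 4) = 0 := by
      have : P2 = 0 := by omega
      have : Pm2 = 0 := by omega
      nlinarith
    have hT1 : T1 = -4 := by
      rcases mul_eq_zero.mp hT with e | e <;> omega
    subst hT1
    have := hcount3 (by omega)
    omega
  -- Here `3 * P2 + Pm2 = 3 * (T1² + 5 * T1 + 7)` and `P2 + Pm2 ≤ 3` confine `T1`, which is odd. For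
  -- `T1 = -1`, `hcount3` gives `S2 ≥ 39`, too many for an involution with an admissible trace. For
  -- `T1 = -3`, the trace of the Coxeter element itself, `Pm1 ≥ 84` violates `hcount1`, whose bound
  -- is `39`.
  · have hQ2 : Q2 = 3 := by omega
    have l : -4 ≤ T1 := by nlinarith
    have u : T1 ≤ -1 := by nlinarith
    have : T1 = -1 ∨ T1 = -3 := by omega
    rcases this with rfl | rfl
    · have h39 := hcount3 (by omega)
      have l : -8 ≤ T3 := by nlinarith
      have u : T3 ≤ 8 := by nlinarith
      have : T3 = 2 ∨ T3 = -4 ∨ T3 = 8 := by omega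
      rcases this with rfl | rfl | rfl <;> omega
    · omega

/-! ### Classification of norm-two vectors, and transitivity -/

/-- The vector with the given list of coordinates. -/
def rowVec (r : List ℕ) : Fin 8 → ℤ := fun i => (r.getD i 0 : ℕ)

/-- The inner products of a vector of `E₈` with the simple roots. -/
def simplePairing (x : Fin 8 → ℤ) : Fin 8 → ℤ :=
  ![2 * x 0 - x 2, 2 * x 1 - x 3, 2 * x 2 - x 0 - x 3, 2 * x 3 - x 1 - x 2 - x 4,
    2 * x 4 - x 3 - x 5, 2 * x 5 - x 4 - x 6, 2 * x 6 - x 5 - x 7, 2 * x 7 - x 6]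

theorem formE8_simple (j : Fin 8) (x : Fin 8 → ℤ) :
    formE8 (Pi.single j 1) x = simplePairing x j := by
  rw [formE8_apply]
  fin_cases j <;> simp [simplePairing]

theorem formE8_simple_self (j : Fin 8) : formE8 (Pi.single j 1) (Pi.single j 1) = 2 := by
  rw [formE8_simple]
  revert j
  decide +kernel

/-- The reflection in a simple root. -/
def simpleReflection (j : Fin 8) : isometryGroup formE8 :=
  reflectionIso formE8_comm (Pi.single j 1) (formE8_simple_self j)

theorem simpleReflection_apply (j : Fin 8) (x : Fin 8 → ℤ) :
    (simpleReflection j).1 x = x - simplePairing x j • Pi.single j 1 := by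
  rw [simpleReflection, reflectionIso_apply, formE8_simple]

theorem simpleReflection_apply_of_ne {i j : Fin 8} (hij : i ≠ j) (x : Fin 8 → ℤ) :
    (simpleReflection j).1 x i = x i := by
  simp [simpleReflection_apply, hij]

theorem simpleReflection_simpleReflection (j : Fin 8) (x : Fin 8 → ℤ) :
    (simpleReflection j).1 ((simpleReflection j).1 x) = x :=
  (simpleReflection j).1.left_inv x

theorem sum_simpleReflection (j : Fin 8) (x : Fin 8 → ℤ) :
    ∑ i, (simpleReflection j).1 x i = ∑ i, x i - simplePairing x j := by
  simp [simpleReflection_apply, Finset.sum_sub_distrib, Pi.single_apply]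

/-- The constant vector is the Weyl vector: it pairs to `1` with every simple root, so it measures
height, and its norm is `620`. The multiplier `18` approximates the optimal `√310`; the resulting
bound is not sharp but suffices for termination. -/
theorem height_lower_bound {x : Fin 8 → ℤ} (hx : formE8 x x = 2) : -36 ≤ ∑ i, x i := by
  have h := formE8_self_nonneg (![46, 68, 91, 135, 110, 84, 57, 29] + (18 : ℤ) • x)
  have e : formE8 (![46, 68, 91, 135, 110, 84, 57, 29] + (18 : ℤ) • x)
      (![46, 68, 91, 135, 110, 84, 57, 29] + (18 : ℤ) • x) =
      620 + 36 * ∑ i, x i + 324 * formE8 x x := by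
    rw [formE8_apply, formE8_apply, Fin.sum_univ_eight]
    simp only [Pi.add_apply, Pi.smul_apply, smul_eq_mul, Matrix.cons_val]
    ring
  rw [e, hx] at h
  omega

/-- Reflecting in a simple root with positive pairing strictly lowers the height, which is bounded
below on norm-two vectors. -/
theorem root_induction {P : (Fin 8 → ℤ) → Prop}
    (h : ∀ x, formE8 x x = 2 →
      (∀ j, 0 < simplePairing x j → P ((simpleReflection j).1 x)) → P x) :
    ∀ x, formE8 x x = 2 → P x := by
  have key : ∀ (n : ℕ) (x : Fin 8 → ℤ), formE8 x x = 2 → ∑ i, x i ≤ n - 36 → P x := by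
    intro n
    induction n with
    | zero =>
      intro x hx hn
      refine h x hx fun j hj => ?_
      have h1 := height_lower_bound (((simpleReflection j).2 x x).trans hx)
      rw [sum_simpleReflection] at h1
      push_cast at hn
      omega
    | succ n ih =>
      intro x hx hn
      refine h x hx fun j hj => ih _ (((simpleReflection j).2 x x).trans hx) ?_
      rw [sum_simpleReflection]
      push_cast at hn
      omega
  intro x hx
  refine key (∑ i, x i + 36).toNat x hx ?_
  have := Int.self_le_toNat (∑ i, x i + 36)
  omega

/-- The lowest root of `E₈`. -/
def lowestRoot : Fin 8 → ℤ := ![-2, -3, -4, -6, -5, -4, -3, -2]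

/-- The only dominant weight of norm `2` of `E₈` is the last fundamental weight. -/
theorem eq_fundamental_weight {m0 m1 m2 m3 m4 m5 m6 m7 : ℤ}
    (h0 : 0 ≤ m0) (h1 : 0 ≤ m1) (h2 : 0 ≤ m2) (h3 : 0 ≤ m3)
    (h4 : 0 ≤ m4) (h5 : 0 ≤ m5) (h6 : 0 ≤ m6) (h7 : 0 ≤ m7)
    (hx : (4 * m0 + 5 * m1 + 7 * m2 + 10 * m3 + 8 * m4 + 6 * m5 + 4 * m6 + 2 * m7) * m0 +
      (5 * m0 + 8 * m1 + 10 * m2 + 15 * m3 + 12 * m4 + 9 * m5 + 6 * m6 + 3 * m7) * m1 +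
      (7 * m0 + 10 * m1 + 14 * m2 + 20 * m3 + 16 * m4 + 12 * m5 + 8 * m6 + 4 * m7) * m2 +
      (10 * m0 + 15 * m1 + 20 * m2 + 30 * m3 + 24 * m4 + 18 * m5 + 12 * m6 + 6 * m7) * m3 +
      (8 * m0 + 12 * m1 + 16 * m2 + 24 * m3 + 20 * m4 + 15 * m5 + 10 * m6 + 5 * m7) * m4 +
      (6 * m0 + 9 * m1 + 12 * m2 + 18 * m3 + 15 * m4 + 12 * m5 + 8 * m6 + 4 * m7) * m5 +
      (4 * m0 + 6 * m1 + 8 * m2 + 12 * m3 + 10 * m4 + 8 * m5 + 6 * m6 + 3 * m7) * m6 +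
      (2 * m0 + 3 * m1 + 4 * m2 + 6 * m3 + 5 * m4 + 4 * m5 + 3 * m6 + 2 * m7) * m7 = 2) :
    m0 = 0 ∧ m1 = 0 ∧ m2 = 0 ∧ m3 = 0 ∧ m4 = 0 ∧ m5 = 0 ∧ m6 = 0 ∧ m7 = 1 := by
  -- Every entry of the inverse Cartan matrix is at least `2`, so the norm is at least twice the
  -- square of the coordinate sum. Hence at most one `m` is nonzero, and only the last diagonal
  -- entry equals `2`.
  have hs : (m0 + m1 + m2 + m3 + m4 + m5 + m6 + m7) *
      (m0 + m1 + m2 + m3 + m4 + m5 + m6 + m7) ≤ 1 := by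
    have p : ∀ {y m s : ℤ}, 0 ≤ m → 2 * s ≤ y → 2 * s * m ≤ y * m := fun hm hy =>
      mul_le_mul_of_nonneg_right hy hm
    have q0 := p (y := 4 * m0 + 5 * m1 + 7 * m2 + 10 * m3 + 8 * m4 + 6 * m5 + 4 * m6 + 2 * m7)
      (s := m0 + m1 + m2 + m3 + m4 + m5 + m6 + m7) h0 (by linarith)
    have q1 := p (y := 5 * m0 + 8 * m1 + 10 * m2 + 15 * m3 + 12 * m4 + 9 * m5 + 6 * m6 + 3 * m7)
      (s := m0 + m1 + m2 + m3 + m4 + m5 + m6 + m7) h1 (by linarith)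
    have q2 := p (y := 7 * m0 + 10 * m1 + 14 * m2 + 20 * m3 + 16 * m4 + 12 * m5 + 8 * m6 + 4 * m7)
      (s := m0 + m1 + m2 + m3 + m4 + m5 + m6 + m7) h2 (by linarith)
    have q3 := p (y := 10 * m0 + 15 * m1 + 20 * m2 + 30 * m3 + 24 * m4 + 18 * m5 + 12 * m6 + 6 * m7)
      (s := m0 + m1 + m2 + m3 + m4 + m5 + m6 + m7) h3 (by linarith)
    have q4 := p (y := 8 * m0 + 12 * m1 + 16 * m2 + 24 * m3 + 20 * m4 + 15 * m5 + 10 * m6 + 5 * m7)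
      (s := m0 + m1 + m2 + m3 + m4 + m5 + m6 + m7) h4 (by linarith)
    have q5 := p (y := 6 * m0 + 9 * m1 + 12 * m2 + 18 * m3 + 15 * m4 + 12 * m5 + 8 * m6 + 4 * m7)
      (s := m0 + m1 + m2 + m3 + m4 + m5 + m6 + m7) h5 (by linarith)
    have q6 := p (y := 4 * m0 + 6 * m1 + 8 * m2 + 12 * m3 + 10 * m4 + 8 * m5 + 6 * m6 + 3 * m7)
      (s := m0 + m1 + m2 + m3 + m4 + m5 + m6 + m7) h6 (by linarith)
    have q7 := p (y := 2 * m0 + 3 * m1 + 4 * m2 + 6 * m3 + 5 * m4 + 4 * m5 + 3 * m6 + 2 * m7)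
      (s := m0 + m1 + m2 + m3 + m4 + m5 + m6 + m7) h7 (by linarith)
    linarith
  have hs1 : m0 + m1 + m2 + m3 + m4 + m5 + m6 + m7 ≤ 1 := by nlinarith
  clear hs
  have c0 : m0 ≠ 1 := fun e => by
    obtain ⟨rfl, rfl, rfl, rfl, rfl, rfl, rfl⟩ : m1 = 0 ∧ m2 = 0 ∧ m3 = 0 ∧ m4 = 0 ∧ m5 = 0 ∧ m6 = 0 ∧ m7 = 0 := by
      clear hx
      omega
    subst e
    norm_num at hx
  have c1 : m1 ≠ 1 := fun e => by
    obtain ⟨rfl, rfl, rfl, rfl, rfl, rfl, rfl⟩ : m0 = 0 ∧ m2 = 0 ∧ m3 = 0 ∧ m4 = 0 ∧ m5 = 0 ∧ m6 = 0 ∧ m7 = 0 := by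
      clear hx
      omega
    subst e
    norm_num at hx
  have c2 : m2 ≠ 1 := fun e => by
    obtain ⟨rfl, rfl, rfl, rfl, rfl, rfl, rfl⟩ : m0 = 0 ∧ m1 = 0 ∧ m3 = 0 ∧ m4 = 0 ∧ m5 = 0 ∧ m6 = 0 ∧ m7 = 0 := by
      clear hx
      omega
    subst e
    norm_num at hx
  have c3 : m3 ≠ 1 := fun e => by
    obtain ⟨rfl, rfl, rfl, rfl, rfl, rfl, rfl⟩ : m0 = 0 ∧ m1 = 0 ∧ m2 = 0 ∧ m4 = 0 ∧ m5 = 0 ∧ m6 = 0 ∧ m7 = 0 := by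
      clear hx
      omega
    subst e
    norm_num at hx
  have c4 : m4 ≠ 1 := fun e => by
    obtain ⟨rfl, rfl, rfl, rfl, rfl, rfl, rfl⟩ : m0 = 0 ∧ m1 = 0 ∧ m2 = 0 ∧ m3 = 0 ∧ m5 = 0 ∧ m6 = 0 ∧ m7 = 0 := by
      clear hx
      omega
    subst e
    norm_num at hx
  have c5 : m5 ≠ 1 := fun e => by
    obtain ⟨rfl, rfl, rfl, rfl, rfl, rfl, rfl⟩ : m0 = 0 ∧ m1 = 0 ∧ m2 = 0 ∧ m3 = 0 ∧ m4 = 0 ∧ m6 = 0 ∧ m7 = 0 := by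
      clear hx
      omega
    subst e
    norm_num at hx
  have c6 : m6 ≠ 1 := fun e => by
    obtain ⟨rfl, rfl, rfl, rfl, rfl, rfl, rfl⟩ : m0 = 0 ∧ m1 = 0 ∧ m2 = 0 ∧ m3 = 0 ∧ m4 = 0 ∧ m5 = 0 ∧ m7 = 0 := by
      clear hx
      omega
    subst e
    norm_num at hx
  have c7 : m7 ≠ 0 := fun e => by
    obtain ⟨rfl, rfl, rfl, rfl, rfl, rfl, rfl⟩ : m0 = 0 ∧ m1 = 0 ∧ m2 = 0 ∧ m3 = 0 ∧ m4 = 0 ∧ m5 = 0 ∧ m6 = 0 := by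
      clear hx
      omega
    subst e
    norm_num at hx
  clear hx
  omega

theorem eq_lowestRoot {x : Fin 8 → ℤ} (hx : formE8 x x = 2)
    (h : ∀ j, simplePairing x j ≤ 0) : x = lowestRoot := by
  have h0 := h 0
  have h1 := h 1
  have h2 := h 2
  have h3 := h 3
  have h4 := h 4
  have h5 := h 5
  have h6 := h 6
  have h7 := h 7
  simp only [simplePairing, Matrix.cons_val] at h0 h1 h2 h3 h4 h5 h6 h7
  rw [formE8_apply] at hx
  obtain ⟨m0, e0⟩ : ∃ m, 2 * x 0 - x 2 = -m := ⟨_, (neg_neg _).symm⟩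
  obtain ⟨m1, e1⟩ : ∃ m, 2 * x 1 - x 3 = -m := ⟨_, (neg_neg _).symm⟩
  obtain ⟨m2, e2⟩ : ∃ m, 2 * x 2 - x 0 - x 3 = -m := ⟨_, (neg_neg _).symm⟩
  obtain ⟨m3, e3⟩ : ∃ m, 2 * x 3 - x 1 - x 2 - x 4 = -m := ⟨_, (neg_neg _).symm⟩
  obtain ⟨m4, e4⟩ : ∃ m, 2 * x 4 - x 3 - x 5 = -m := ⟨_, (neg_neg _).symm⟩
  obtain ⟨m5, e5⟩ : ∃ m, 2 * x 5 - x 4 - x 6 = -m := ⟨_, (neg_neg _).symm⟩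
  obtain ⟨m6, e6⟩ : ∃ m, 2 * x 6 - x 5 - x 7 = -m := ⟨_, (neg_neg _).symm⟩
  obtain ⟨m7, e7⟩ : ∃ m, 2 * x 7 - x 6 = -m := ⟨_, (neg_neg _).symm⟩
  rw [e0, e1, e2, e3, e4, e5, e6, e7] at hx
  rw [e0] at h0
  rw [e1] at h1
  rw [e2] at h2
  rw [e3] at h3
  rw [e4] at h4
  rw [e5] at h5
  rw [e6] at h6
  rw [e7] at h7
  have x0 : x 0 = -(4 * m0 + 5 * m1 + 7 * m2 + 10 * m3 + 8 * m4 + 6 * m5 + 4 * m6 + 2 * m7) := by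
    linarith
  have x1 : x 1 = -(5 * m0 + 8 * m1 + 10 * m2 + 15 * m3 + 12 * m4 + 9 * m5 + 6 * m6 + 3 * m7) := by
    linarith
  have x2 : x 2 = -(7 * m0 + 10 * m1 + 14 * m2 + 20 * m3 + 16 * m4 + 12 * m5 + 8 * m6 + 4 * m7) := by
    linarith
  have x3 : x 3 = -(10 * m0 + 15 * m1 + 20 * m2 + 30 * m3 + 24 * m4 + 18 * m5 + 12 * m6 +
      6 * m7) := by
    linarith
  have x4 : x 4 = -(8 * m0 + 12 * m1 + 16 * m2 + 24 * m3 + 20 * m4 + 15 * m5 + 10 * m6 + 5 * m7) := by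
    linarith
  have x5 : x 5 = -(6 * m0 + 9 * m1 + 12 * m2 + 18 * m3 + 15 * m4 + 12 * m5 + 8 * m6 + 4 * m7) := by
    linarith
  have x6 : x 6 = -(4 * m0 + 6 * m1 + 8 * m2 + 12 * m3 + 10 * m4 + 8 * m5 + 6 * m6 + 3 * m7) := by
    linarith
  have x7 : x 7 = -(2 * m0 + 3 * m1 + 4 * m2 + 6 * m3 + 5 * m4 + 4 * m5 + 3 * m6 + 2 * m7) := by
    linarith
  rw [x0, x1, x2, x3, x4, x5, x6, x7] at hx
  have hm := eq_fundamental_weight (m0 := m0) (m1 := m1) (m2 := m2) (m3 := m3) (m4 := m4)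
    (m5 := m5) (m6 := m6) (m7 := m7) (by linarith) (by linarith) (by linarith) (by linarith)
    (by linarith) (by linarith) (by linarith) (by linarith) (by linear_combination hx)
  obtain ⟨rfl, rfl, rfl, rfl, rfl, rfl, rfl, rfl⟩ := hm
  ext i
  fin_cases i <;> simp [lowestRoot, *]

/-- The sums of the coordinates adjacent to a given one in the Dynkin diagram of type `E₈`. -/
def neighborSum (r : List ℕ) : Fin 8 → ℕ :=
  ![r.getD 2 0, r.getD 3 0, r.getD 0 0 + r.getD 3 0, r.getD 1 0 + r.getD 2 0 + r.getD 4 0,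
    r.getD 3 0 + r.getD 5 0, r.getD 4 0 + r.getD 6 0, r.getD 5 0 + r.getD 7 0, r.getD 6 0]

theorem posRows_length : ∀ r ∈ posRows, r.length = 8 := by decide +kernel

/-- Closure of the list under simple reflections: a reflection replaces one coefficient `c` by the
neighbour sum minus `c`. Only the simple root itself becomes negative, and elsewhere the inequality
makes natural subtraction exact. -/
theorem posRows_reflection : ∀ r ∈ posRows, ∀ j : Fin 8,
    r = (List.replicate 8 0).set j 1 ∨
    (r.getD j 0 ≤ neighborSum r j ∧
      r.set j (neighborSum r j - r.getD j 0) ∈ posRows) := by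
  decide +kernel

theorem simplePairing_rowVec (r : List ℕ) (j : Fin 8) :
    simplePairing (rowVec r) j = 2 * (r.getD j 0 : ℕ) - neighborSum r j := by
  fin_cases j <;> simp [simplePairing, rowVec, neighborSum] <;> ring

theorem simpleReflection_rowVec {r : List ℕ} (hr : r ∈ posRows) (j : Fin 8) :
    ∃ s ∈ posRows, (simpleReflection j).1 (rowVec r) = rowVec s ∨
      (simpleReflection j).1 (rowVec r) = -rowVec s := by
  rcases posRows_reflection r hr j with h | ⟨h1, h2⟩
  · refine ⟨r, hr, Or.inr ?_⟩
    have : rowVec r = Pi.single j 1 := by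
      rw [h]
      clear h
      revert j
      decide +kernel
    rw [this, simpleReflection_apply, ← formE8_simple, formE8_simple_self]
    module
  · refine ⟨_, h2, Or.inl ?_⟩
    rw [simpleReflection_apply, simplePairing_rowVec]
    ext i
    by_cases hij : i = j
    · subst hij
      have e : (r.set i (neighborSum r i - r.getD i 0)).getD i 0 =
          neighborSum r i - r.getD i 0 := by
        simp [List.getD_eq_getElem?_getD, posRows_length r hr]
      simp only [rowVec, Pi.sub_apply, Pi.smul_apply, Pi.single_eq_same, smul_eq_mul, mul_one, e]
      push_cast [Nat.cast_sub h1]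
      ring
    · have : (j : ℕ) ≠ i := fun e => hij (Fin.ext e.symm)
      simp [rowVec, hij, List.getD_eq_getElem?_getD, List.getElem?_set_ne this]

/-- The vectors of norm `2` of `E₈` are the positive roots and their negatives. -/
theorem exists_row_of_norm_two : ∀ x : Fin 8 → ℤ, formE8 x x = 2 →
    ∃ r ∈ posRows, x = rowVec r ∨ x = -rowVec r := by
  refine root_induction fun x hx ih => ?_
  by_cases h : ∀ j, simplePairing x j ≤ 0
  · rw [eq_lowestRoot hx h]
    decide +kernel
  · push Not at h
    obtain ⟨j, hj⟩ := h
    obtain ⟨r, hr, h | h⟩ := ih j hj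
    · rw [← simpleReflection_simpleReflection j x, h]
      exact simpleReflection_rowVec hr j
    · rw [← simpleReflection_simpleReflection j x, h, map_neg]
      obtain ⟨s, hs, h' | h'⟩ := simpleReflection_rowVec hr j
      · exact ⟨s, hs, Or.inr (by rw [h'])⟩
      · exact ⟨s, hs, Or.inl (by rw [h', neg_neg])⟩

theorem rowVec_nonneg (r : List ℕ) (i : Fin 8) : 0 ≤ rowVec r i := Int.natCast_nonneg _

theorem exists_isometry_lowestRoot : ∀ x : Fin 8 → ℤ, formE8 x x = 2 →
    ∃ g : isometryGroup formE8, g.1 x = lowestRoot := by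
  refine root_induction fun x hx ih => ?_
  by_cases h : ∀ j, simplePairing x j ≤ 0
  · exact ⟨1, eq_lowestRoot hx h⟩
  · push Not at h
    obtain ⟨j, hj⟩ := h
    obtain ⟨g, hg⟩ := ih j hj
    exact ⟨g * simpleReflection j, hg⟩

/-- This keeps the descent inside the parabolic subgroup of the first `k` simple reflections: the
only row of this shape that none of them lowers is the simple root. -/
theorem posRows_descent : ∀ r ∈ posRows, ∀ k : Fin 8, 4 ≤ k → (∀ i, k < i → r.getD i 0 = 0) →
    r.getD k 0 = 1 → r = (List.replicate 8 0).set k 1 ∨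
      ∃ j < k, neighborSum r j < 2 * r.getD j 0 := by
  decide +kernel

theorem rowVec_simple (k : Fin 8) : rowVec ((List.replicate 8 0).set k 1) = Pi.single k 1 := by
  revert k
  decide +kernel

/-- A root with last nonzero coordinate `1` in position `k ≥ 4` is moved to the `k`-th simple root
by the reflections in the preceding simple roots. -/
theorem exists_isometry_simple {k : Fin 8} (hk : 4 ≤ k) : ∀ x : Fin 8 → ℤ, formE8 x x = 2 →
    (∀ i, k < i → x i = 0) → x k = 1 →
    ∃ g : isometryGroup formE8, g.1 x = Pi.single k 1 ∧
      ∀ y, (∀ j < k, simplePairing y j = 0) → g.1 y = y := by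
  refine root_induction fun x hx ih h0 h1 => ?_
  obtain ⟨r, hr, rfl | rfl⟩ := exists_row_of_norm_two x hx
  · rcases posRows_descent r hr k hk (fun i hi => Int.natCast_eq_zero.mp (h0 i hi))
      (Nat.cast_eq_one.mp h1) with h | ⟨j, hjk, hj⟩
    · exact ⟨1, by rw [h, rowVec_simple]; rfl, fun y _ => rfl⟩
    · obtain ⟨g, hg, hg'⟩ := ih j (by rw [simplePairing_rowVec]; omega)
        (fun i hi => by rw [simpleReflection_apply_of_ne (hjk.trans hi).ne', h0 i hi])
        (by rw [simpleReflection_apply_of_ne hjk.ne', h1])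
      refine ⟨g * simpleReflection j, hg, fun y hy => ?_⟩
      change g.1 ((simpleReflection j).1 y) = y
      rw [simpleReflection_apply, hy j hjk, zero_smul, sub_zero, hg' y hy]
  · have := rowVec_nonneg r k
    simp only [Pi.neg_apply] at h1
    omega

/-! ### Coxeter elements on frames, and existence of a frame -/

/-- The Gram matrix of a system of simple roots of type `A₅ + A₂ + A₁`. -/
def gramA5A2A1 : Fin 8 → Fin 8 → ℤ :=
  ![![2, -1, 0, 0, 0, 0, 0, 0],
    ![-1, 2, -1, 0, 0, 0, 0, 0],
    ![0, -1, 2, -1, 0, 0, 0, 0],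
    ![0, 0, -1, 2, -1, 0, 0, 0],
    ![0, 0, 0, -1, 2, 0, 0, 0],
    ![0, 0, 0, 0, 0, 2, -1, 0],
    ![0, 0, 0, 0, 0, -1, 2, 0],
    ![0, 0, 0, 0, 0, 0, 0, 2]]

/-- A system of simple roots of type `A₅ + A₂ + A₁` in `E₈`. -/
def IsFrame (F : Fin 8 → Fin 8 → ℤ) : Prop :=
  ∀ i j, formE8 (F i) (F j) = gramA5A2A1 i j

/-- The images of the simple roots of `A₅ + A₂ + A₁` under the standard Coxeter element. -/
def coxeterImage {M : Type*} [AddCommGroup M] (F : Fin 8 → M) : Fin 8 → M :=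
  ![F 1, F 2, F 3, F 4, -(F 0 + F 1 + F 2 + F 3 + F 4), F 6, -(F 5 + F 6), -F 7]

/-- The isometry `h` acts on the frame `F` as a Coxeter element. -/
def ActsOn (h : isometryGroup formE8) (F : Fin 8 → Fin 8 → ℤ) : Prop :=
  ∀ i, h.1 (F i) = coxeterImage F i

theorem coxeterImage_map {M N : Type*} [AddCommGroup M] [AddCommGroup N] (f : M →+ N)
    (F : Fin 8 → M) (i : Fin 8) : coxeterImage (fun j => f (F j)) i = f (coxeterImage F i) := by
  fin_cases i <;> simp [coxeterImage]

theorem IsFrame.map {F : Fin 8 → Fin 8 → ℤ} (hF : IsFrame F) (g : isometryGroup formE8) :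
    IsFrame fun i => g.1 (F i) := fun i j => (g.2 _ _).trans (hF i j)

theorem ActsOn.map {h : isometryGroup formE8} {F : Fin 8 → Fin 8 → ℤ} (hF : ActsOn h F)
    (g : isometryGroup formE8) : ActsOn (g * h * g⁻¹) fun i => g.1 (F i) := fun i => by
  have : (g * h * g⁻¹).1 (g.1 (F i)) = g.1 (h.1 (F i)) :=
    congrArg (fun y => g.1 (h.1 y)) (g.1.symm_apply_apply (F i))
  rw [this, hF i]
  exact (coxeterImage_map (g.1 : (Fin 8 → ℤ) →+ (Fin 8 → ℤ)) F i).symm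

theorem formE8_lowestRoot (x : Fin 8 → ℤ) : formE8 lowestRoot x = -x 7 := by
  rw [formE8_apply]
  simp only [lowestRoot, Matrix.cons_val]
  ring

/-- Isometries act transitively on the systems of simple roots of type `A₅`. -/
theorem exists_isometry_chain {x1 x2 x3 x4 x5 : Fin 8 → ℤ}
    (h11 : formE8 x1 x1 = 2) (h22 : formE8 x2 x2 = 2) (h33 : formE8 x3 x3 = 2)
    (h44 : formE8 x4 x4 = 2) (h55 : formE8 x5 x5 = 2)
    (h12 : formE8 x1 x2 = -1) (h23 : formE8 x2 x3 = -1) (h34 : formE8 x3 x4 = -1)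
    (h45 : formE8 x4 x5 = -1) (h13 : formE8 x1 x3 = 0) (h14 : formE8 x1 x4 = 0)
    (h15 : formE8 x1 x5 = 0) (h24 : formE8 x2 x4 = 0) (h25 : formE8 x2 x5 = 0)
    (h35 : formE8 x3 x5 = 0) :
    ∃ g : isometryGroup formE8, g.1 x1 = lowestRoot ∧ g.1 x2 = Pi.single 7 1 ∧
      g.1 x3 = Pi.single 6 1 ∧ g.1 x4 = Pi.single 5 1 ∧ g.1 x5 = Pi.single 4 1 := by
  -- The reflections used to place each root fix the roots already placed, since those are
  -- orthogonal to the preceding simple roots.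
  have fix1 : ∀ j < (7 : Fin 8), simplePairing lowestRoot j = 0 := by decide +kernel
  have fix2 : ∀ j < (6 : Fin 8), simplePairing (Pi.single 7 1) j = 0 := by decide +kernel
  have fix3 : ∀ j < (5 : Fin 8), simplePairing (Pi.single 6 1) j = 0 := by decide +kernel
  have fix4 : ∀ j < (4 : Fin 8), simplePairing (Pi.single 5 1) j = 0 := by decide +kernel
  have c7 : ∀ x : Fin 8 → ℤ, ∀ i, 7 < i → x i = 0 := fun x i hi => by
    exact absurd hi (by revert i; decide)
  obtain ⟨g1, e1⟩ := exists_isometry_lowestRoot x1 h11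
  have A : ∀ (g : isometryGroup formE8) {x y : Fin 8 → ℤ} {z : ℤ}, formE8 x y = z →
      formE8 (g.1 x) (g.1 y) = z := fun g x y z e => (g.2 x y).trans e
  have B1 : ∀ {g : isometryGroup formE8} {x y : Fin 8 → ℤ} {z : ℤ}, g.1 x = lowestRoot →
      formE8 x y = z → g.1 y 7 = -z := fun {g x y z} e e' => by
    rw [← g.2, e, formE8_lowestRoot] at e'
    omega
  have B2 : ∀ {g : isometryGroup formE8} {x y : Fin 8 → ℤ} {z : ℤ} {j : Fin 8},
      g.1 x = Pi.single j 1 → formE8 x y = z → simplePairing (g.1 y) j = z :=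
    fun {g x y z j} e e' => by rw [← e', ← g.2, e, formE8_simple]
  obtain ⟨g2, e2, f2⟩ := exists_isometry_simple (k := 7) (by decide) _ (A g1 h22) (c7 _)
    (by rw [B1 e1 h12]; rfl)
  have p1 : (g2 * g1).1 x1 = lowestRoot := (congrArg g2.1 e1).trans (f2 _ fix1)
  have p2 : (g2 * g1).1 x2 = Pi.single 7 1 := e2
  -- The pairings with the placed roots determine the top coordinates: here coordinate `7` is `0`
  -- and then coordinate `6` is `1`, as the descent requires. The later stages are the same.
  have d3 := B1 p1 h13
  have d3' := B2 p2 h23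
  simp only [simplePairing, Matrix.cons_val] at d3'
  obtain ⟨g3, e3, f3⟩ := exists_isometry_simple (k := 6) (by decide) _ (A (g2 * g1) h33)
    (fun i hi => by
      obtain rfl : i = 7 := by revert i; decide
      omega) (by omega)
  have q1 : (g3 * (g2 * g1)).1 x1 = lowestRoot :=
    (congrArg g3.1 p1).trans (f3 _ fun j hj => fix1 j (hj.trans (by decide)))
  have q2 : (g3 * (g2 * g1)).1 x2 = Pi.single 7 1 := (congrArg g3.1 p2).trans (f3 _ fix2)
  have q3 : (g3 * (g2 * g1)).1 x3 = Pi.single 6 1 := e3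
  have d4 := B1 q1 h14
  have d4' := B2 q2 h24
  have d4'' := B2 q3 h34
  simp only [simplePairing, Matrix.cons_val] at d4' d4''
  obtain ⟨g4, e4, f4⟩ := exists_isometry_simple (k := 5) (by decide) _ (A (g3 * (g2 * g1)) h44)
    (fun i hi => by
      obtain rfl | rfl : i = 6 ∨ i = 7 := by revert i; decide
      all_goals omega) (by omega)
  have r1 : (g4 * (g3 * (g2 * g1))).1 x1 = lowestRoot :=
    (congrArg g4.1 q1).trans (f4 _ fun j hj => fix1 j (hj.trans (by decide)))
  have r2 : (g4 * (g3 * (g2 * g1))).1 x2 = Pi.single 7 1 :=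
    (congrArg g4.1 q2).trans (f4 _ fun j hj => fix2 j (hj.trans (by decide)))
  have r3 : (g4 * (g3 * (g2 * g1))).1 x3 = Pi.single 6 1 := (congrArg g4.1 q3).trans (f4 _ fix3)
  have r4 : (g4 * (g3 * (g2 * g1))).1 x4 = Pi.single 5 1 := e4
  have d5 := B1 r1 h15
  have d5' := B2 r2 h25
  have d5'' := B2 r3 h35
  have d5''' := B2 r4 h45
  simp only [simplePairing, Matrix.cons_val] at d5' d5'' d5'''
  obtain ⟨g5, e5, f5⟩ := exists_isometry_simple (k := 4) (by decide) _
    (A (g4 * (g3 * (g2 * g1))) h55)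
    (fun i hi => by
      obtain rfl | rfl | rfl : i = 5 ∨ i = 6 ∨ i = 7 := by revert i; decide
      all_goals omega) (by omega)
  exact ⟨g5 * (g4 * (g3 * (g2 * g1))),
    (congrArg g5.1 r1).trans (f5 _ fun j hj => fix1 j (hj.trans (by decide))),
    (congrArg g5.1 r2).trans (f5 _ fun j hj => fix2 j (hj.trans (by decide))),
    (congrArg g5.1 r3).trans (f5 _ fun j hj => fix3 j (hj.trans (by decide))),
    (congrArg g5.1 r4).trans (f5 _ fix4), e5⟩

/-- The roots orthogonal to the standard `A₅`. -/
def orthogonalRoots : List (Fin 8 → ℤ) :=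
  [![1, 0, 0, 0, 0, 0, 0, 0], ![0, 0, 1, 0, 0, 0, 0, 0], ![1, 0, 1, 0, 0, 0, 0, 0],
    ![0, 1, 0, 0, 0, 0, 0, 0], ![-1, 0, 0, 0, 0, 0, 0, 0], ![0, 0, -1, 0, 0, 0, 0, 0],
    ![-1, 0, -1, 0, 0, 0, 0, 0], ![0, -1, 0, 0, 0, 0, 0, 0]]

theorem posRows_orthogonal : ∀ r ∈ posRows, (∀ i : Fin 8, 3 ≤ i → r.getD i 0 = 0) →
    rowVec r ∈ orthogonalRoots ∧ -rowVec r ∈ orthogonalRoots := by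
  decide +kernel

theorem mem_orthogonalRoots {x : Fin 8 → ℤ} (hx : formE8 x x = 2)
    (h0 : formE8 lowestRoot x = 0) (h1 : ∀ j : Fin 8, 4 ≤ j → formE8 (Pi.single j 1) x = 0) :
    x ∈ orthogonalRoots := by
  have h4 := h1 4 (by decide)
  have h5 := h1 5 (by decide)
  have h6 := h1 6 (by decide)
  have h7 := h1 7 (by decide)
  rw [formE8_lowestRoot] at h0
  rw [formE8_simple] at h4 h5 h6 h7
  simp only [simplePairing, Matrix.cons_val] at h4 h5 h6 h7
  have hz : ∀ i : Fin 8, 3 ≤ i → x i = 0 := fun i hi => by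
    obtain rfl | rfl | rfl | rfl | rfl : i = 3 ∨ i = 4 ∨ i = 5 ∨ i = 6 ∨ i = 7 := by
      revert i; decide
    all_goals omega
  obtain ⟨r, hr, rfl | rfl⟩ := exists_row_of_norm_two x hx
  · exact (posRows_orthogonal r hr fun i hi => Int.natCast_eq_zero.mp (hz i hi)).1
  · exact (posRows_orthogonal r hr fun i hi =>
      Int.natCast_eq_zero.mp (neg_eq_zero.mp (hz i hi))).2

/-- An explicit formula for the form of `E₈`. -/
def pairE8 (x y : Fin 8 → ℤ) : ℤ :=
  x 0 * (2 * y 0 - y 2) + x 1 * (2 * y 1 - y 3) + x 2 * (2 * y 2 - y 0 - y 3) +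
    x 3 * (2 * y 3 - y 1 - y 2 - y 4) + x 4 * (2 * y 4 - y 3 - y 5) +
    x 5 * (2 * y 5 - y 4 - y 6) + x 6 * (2 * y 6 - y 5 - y 7) + x 7 * (2 * y 7 - y 6)

/-- Six times `h w - w`, for an isometry `h` acting on the standard `A₅` as a Coxeter element and
with the images `p`, `q`, `s` of the simple roots with indices `2`, `0`, `1`. -/
def sixfoldDifference (p q s w : Fin 8 → ℤ) : Fin 8 → ℤ := fun i =>
  6 * (w 0 * q i + w 1 * s i + w 2 * p i) -
    w 3 * ((![10, 15, 20, 30, 24, 18, 12, 6] : Fin 8 → ℤ) i + 4 * p i + 2 * q i + 3 * s i) +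
    6 * (![2, 3, 4, 6, 4, 3, 2, 1] : Fin 8 → ℤ) i * w 4 +
    6 * (![0, 0, 0, 0, w 5, w 6, w 7, 0] : Fin 8 → ℤ) i - 6 * w i

/-- All candidate images of the simple roots of `A₂ + A₁` are checked. Besides the two orientations
of the `A₂` Coxeter element with `-1` on `A₁`, either the image of the remaining simple root is not
integral, or some `w` violates rootlessness; `72` is `36 * 2` because of the sixfold scaling. -/
theorem orthogonalRoots_cases : ∀ p ∈ orthogonalRoots, ∀ q ∈ orthogonalRoots,
    ∀ s ∈ orthogonalRoots, pairE8 p q = -1 → pairE8 p s = 0 → pairE8 q s = 0 →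
    (p = ![1, 0, 0, 0, 0, 0, 0, 0] ∧ q = ![-1, 0, -1, 0, 0, 0, 0, 0] ∧
      s = ![0, -1, 0, 0, 0, 0, 0, 0]) ∨
    (p = ![-1, 0, -1, 0, 0, 0, 0, 0] ∧ q = ![0, 0, 1, 0, 0, 0, 0, 0] ∧
      s = ![0, -1, 0, 0, 0, 0, 0, 0]) ∨
    (∃ i : Fin 8, (![10, 15, 20, 30, 24, 18, 12, 6] i + 4 * p i + 2 * q i + 3 * s i) % 6 ≠ 0) ∨
    ∃ w ∈ ([![1, 0, 0, 0, 0, 0, 0, 0], ![0, 0, 1, 0, 0, 0, 0, 0], ![0, 0, 0, 1, 0, 0, 0, 0],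
      ![1, 1, 2, 3, 2, 1, 0, 0], ![0, 1, 1, 2, 1, 0, 0, 0]] : List (Fin 8 → ℤ)),
      pairE8 (sixfoldDifference p q s w) (sixfoldDifference p q s w) = 72 := by
  decide +kernel

theorem IsRootless.conj {h : isometryGroup formE8} (hr : IsRootless h)
    (g : isometryGroup formE8) : IsRootless (g * h * g⁻¹) := fun x => by
  have e : (g * h * g⁻¹).1 x - x = g.1 (h.1 (g⁻¹.1 x) - g⁻¹.1 x) := by
    rw [map_sub]
    exact congrArg _ (g.1.apply_symm_apply x).symm
  rw [e, g.2]
  exact hr _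

/-- The isometry preserves the standard `A₅` and so permutes the roots orthogonal to it. The
relation between the lowest root and the simple roots expresses six times the branch root through
`A₅ + A₂ + A₁`, so the images on `A₂ + A₁` determine `h`. -/
theorem IsRootless.exists_frame_of_standard {h : isometryGroup formE8} (hr : IsRootless h)
    (h1 : h.1 lowestRoot = Pi.single 7 1) (h2 : h.1 (Pi.single 7 1) = Pi.single 6 1)
    (h3 : h.1 (Pi.single 6 1) = Pi.single 5 1) (h4 : h.1 (Pi.single 5 1) = Pi.single 4 1)
    (h5 : h.1 (Pi.single 4 1) = ![2, 3, 4, 6, 4, 3, 2, 1]) :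
    ∃ F, IsFrame F ∧ ActsOn h F := by
  have mem : ∀ x, formE8 x x = 2 → formE8 lowestRoot x = 0 →
      (∀ j : Fin 8, 4 ≤ j → formE8 (Pi.single j 1) x = 0) → h.1 x ∈ orthogonalRoots := by
    intro x hx hl hj
    have k7 : formE8 (Pi.single 7 1) (h.1 x) = 0 := by rw [← h1, h.2, hl]
    have k6 : formE8 (Pi.single 6 1) (h.1 x) = 0 := by rw [← h2, h.2, hj 7 (by decide)]
    have k5 : formE8 (Pi.single 5 1) (h.1 x) = 0 := by rw [← h3, h.2, hj 6 (by decide)]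
    have k4 : formE8 (Pi.single 4 1) (h.1 x) = 0 := by rw [← h4, h.2, hj 5 (by decide)]
    have k : formE8 ![2, 3, 4, 6, 4, 3, 2, 1] (h.1 x) = 0 := by rw [← h5, h.2, hj 4 (by decide)]
    refine mem_orthogonalRoots ((h.2 x x).trans hx) ?_ fun j hj => ?_
    · have : lowestRoot = -(![2, 3, 4, 6, 4, 3, 2, 1] + Pi.single 4 1 + Pi.single 5 1 +
          Pi.single 6 1 + Pi.single 7 1) := by decide +kernel
      rw [this]
      simp only [map_neg, map_add, LinearMap.neg_apply, LinearMap.add_apply, k, k4, k5, k6, k7]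
      norm_num
    · obtain rfl | rfl | rfl | rfl : j = 4 ∨ j = 5 ∨ j = 6 ∨ j = 7 := by
        revert j; decide
      all_goals assumption
  have e : ∀ {x y : Fin 8 → ℤ} {z : ℤ}, pairE8 x y = z → formE8 x y = z :=
    fun {x y z} h => (formE8_apply x y).trans h
  have pair : ∀ {x y : Fin 8 → ℤ} {z : ℤ}, pairE8 x y = z → pairE8 (h.1 x) (h.1 y) = z :=
    fun {x y z} hz => (formE8_apply _ _).symm.trans ((h.2 x y).trans (e hz))
  have mp := mem (Pi.single 2 1) (e (by decide +kernel)) (e (by decide +kernel))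
    fun j hj => e (by revert j; decide +kernel)
  have mq := mem (Pi.single 0 1) (e (by decide +kernel)) (e (by decide +kernel))
    fun j hj => e (by revert j; decide +kernel)
  have ms := mem (Pi.single 1 1) (e (by decide +kernel)) (e (by decide +kernel))
    fun j hj => e (by revert j; decide +kernel)
  have six : (6 : ℤ) • h.1 (Pi.single 3 1) = -(![10, 15, 20, 30, 24, 18, 12, 6] +
      (4 : ℤ) • h.1 (Pi.single 2 1) + (2 : ℤ) • h.1 (Pi.single 0 1) +
      (3 : ℤ) • h.1 (Pi.single 1 1)) := by
    have r1 : (6 : ℤ) • (Pi.single 3 1 : Fin 8 → ℤ) = -(lowestRoot + (2 : ℤ) • Pi.single 7 1 +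
        (3 : ℤ) • Pi.single 6 1 + (4 : ℤ) • Pi.single 5 1 + (5 : ℤ) • Pi.single 4 1 +
        (4 : ℤ) • Pi.single 2 1 + (2 : ℤ) • Pi.single 0 1 + (3 : ℤ) • Pi.single 1 1) := by
      decide +kernel
    have r2 : (![10, 15, 20, 30, 24, 18, 12, 6] : Fin 8 → ℤ) = Pi.single 7 1 +
        (2 : ℤ) • Pi.single 6 1 + (3 : ℤ) • Pi.single 5 1 + (4 : ℤ) • Pi.single 4 1 +
        (5 : ℤ) • ![2, 3, 4, 6, 4, 3, 2, 1] := by decide +kernel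
    rw [← map_smul, r1, r2]
    simp only [map_neg, map_add, map_smul, h1, h2, h3, h4, h5]
  have diff : ∀ w, (6 : ℤ) • (h.1 w - w) = sixfoldDifference (h.1 (Pi.single 2 1))
      (h.1 (Pi.single 0 1)) (h.1 (Pi.single 1 1)) w := by
    intro w
    have hw : w = w 0 • Pi.single 0 1 + w 1 • Pi.single 1 1 + w 2 • Pi.single 2 1 +
        w 3 • Pi.single 3 1 + w 4 • Pi.single 4 1 + w 5 • Pi.single 5 1 + w 6 • Pi.single 6 1 +
        w 7 • Pi.single 7 1 := by
      ext i
      fin_cases i <;> simp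
    have hhw := congrArg h.1 hw
    simp only [map_add, map_smul, h2, h3, h4, h5] at hhw
    ext i
    have s6 := congrFun six i
    have hi := congrFun hhw i
    simp only [Pi.smul_apply, Pi.add_apply, Pi.neg_apply, smul_eq_mul] at s6 hi
    simp only [Pi.smul_apply, Pi.sub_apply, smul_eq_mul, hi, sixfoldDifference]
    have t : w 5 * (Pi.single 4 1 : Fin 8 → ℤ) i + w 6 * (Pi.single 5 1 : Fin 8 → ℤ) i +
        w 7 * (Pi.single 6 1 : Fin 8 → ℤ) i = (![0, 0, 0, 0, w 5, w 6, w 7, 0] : Fin 8 → ℤ) i := by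
      fin_cases i <;> simp
    rw [← t]
    linear_combination w 3 * s6
  rcases orthogonalRoots_cases _ mp _ mq _ ms (pair (by decide +kernel)) (pair (by decide +kernel))
    (pair (by decide +kernel)) with ⟨kp, kq, ks⟩ | ⟨kp, kq, ks⟩ | ⟨i, hi⟩ | ⟨w, -, hw⟩
  · refine ⟨![lowestRoot, Pi.single 7 1, Pi.single 6 1, Pi.single 5 1, Pi.single 4 1,
      Pi.single 2 1, Pi.single 0 1, Pi.single 1 1], fun i j => e ?_, fun i => ?_⟩
    · revert i j
      decide +kernel
    · fin_cases i
      · exact h1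
      · exact h2
      · exact h3
      · exact h4
      · exact h5.trans (by decide +kernel)
      · exact kp.trans (by decide +kernel)
      · exact kq.trans (by decide +kernel)
      · exact ks.trans (by decide +kernel)
  · refine ⟨![lowestRoot, Pi.single 7 1, Pi.single 6 1, Pi.single 5 1, Pi.single 4 1,
      Pi.single 0 1, Pi.single 2 1, Pi.single 1 1], fun i j => e ?_, fun i => ?_⟩
    · revert i j
      decide +kernel
    · fin_cases i
      · exact h1
      · exact h2
      · exact h3
      · exact h4
      · exact h5.trans (by decide +kernel)
      · exact kq.trans (by decide +kernel)
      · exact kp.trans (by decide +kernel)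
      · exact ks.trans (by decide +kernel)
  · have s6 := congrFun six i
    simp only [Pi.smul_apply, Pi.add_apply, Pi.neg_apply, smul_eq_mul] at s6
    omega
  · have h72 := e hw
    rw [← diff w] at h72
    simp only [map_smul, LinearMap.smul_apply, smul_eq_mul] at h72
    exact absurd (by omega) (hr w)

/-- A rootless isometry of order `6` of `E₈` acts as a Coxeter element on a system of simple roots
of type `A₅ + A₂ + A₁`. -/
theorem IsRootless.exists_frame {h : isometryGroup formE8} (hr : IsRootless h)
    (hord : orderOf h = 6) : ∃ F, IsFrame F ∧ ActsOn h F := by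
  obtain ⟨r, hr0, hr1, hr2, hr3, hsum⟩ := hr.exists_orbit_A5 hord
  have e2 : (h ^ 2).1 r = h.1 (h.1 r) := by rw [coe_pow_apply, pow_one]
  have e3 : (h ^ 3).1 r = h.1 (h.1 (h.1 r)) := by rw [coe_pow_apply, e2]
  have e4 : (h ^ 4).1 r = h.1 (h.1 (h.1 (h.1 r))) := by rw [coe_pow_apply, e3]
  have e5 : (h ^ 5).1 r = h.1 (h.1 (h.1 (h.1 (h.1 r)))) := by rw [coe_pow_apply, e4]
  rw [e2, e3, e4, e5] at hsum
  rw [e2] at hr2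
  rw [e3] at hr3
  -- Pairing `r` with the vanishing orbit sum gives the missing orthogonality, as the two neighbours
  -- of `r` in the cycle contribute `-1` each.
  have hr4 : formE8 r (h.1 (h.1 (h.1 (h.1 r)))) = 0 := by
    have := congrArg (formE8 r) hsum
    simp only [map_add, map_zero, hr0, hr1, hr2, hr3] at this
    have h5 : formE8 r (h.1 (h.1 (h.1 (h.1 (h.1 r))))) = -1 := by
      have h6 : h ^ 6 = 1 := hord ▸ pow_orderOf_eq_one h
      have e6 : h.1 ((h ^ 5).1 r) = r := by
        rw [← coe_pow_apply, h6]; rfl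
      rw [← e5, ← h.2, e6, formE8_comm, hr1]
    omega
  have hh : ∀ x y, formE8 (h.1 x) (h.1 y) = formE8 x y := h.2
  obtain ⟨g, g1, g2, g3, g4, g5⟩ := exists_isometry_chain (x1 := r) (x2 := h.1 r)
    (x3 := h.1 (h.1 r)) (x4 := h.1 (h.1 (h.1 r))) (x5 := h.1 (h.1 (h.1 (h.1 r))))
    hr0 (by simp only [hh, hr0]) (by simp only [hh, hr0]) (by simp only [hh, hr0])
    (by simp only [hh, hr0]) hr1 (by simp only [hh, hr1]) (by simp only [hh, hr1])
    (by simp only [hh, hr1]) hr2 hr3 hr4 (by simp only [hh, hr2]) (by simp only [hh, hr3])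
    (by simp only [hh, hr2])
  have cj : ∀ {x y z : Fin 8 → ℤ}, g.1 x = y → g.1 (h.1 x) = z → (g * h * g⁻¹).1 y = z :=
    fun {x y z} hx hz => by
      rw [← hx, ← hz]
      exact congrArg (fun y => g.1 (h.1 y)) (g.1.symm_apply_apply x)
  have g6 : g.1 (h.1 (h.1 (h.1 (h.1 (h.1 r))))) = ![2, 3, 4, 6, 4, 3, 2, 1] := by
    have := congrArg g.1 (eq_neg_of_add_eq_zero_right hsum)
    rw [this]
    simp only [map_neg, map_add, g1, g2, g3, g4, g5]
    decide +kernel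
  obtain ⟨F, hF, hF'⟩ := (hr.conj g).exists_frame_of_standard (cj g1 g2) (cj g2 g3) (cj g3 g4)
    (cj g4 g5) (cj g5 g6)
  refine ⟨_, hF.map g⁻¹, ?_⟩
  have := hF'.map g⁻¹
  rwa [show g⁻¹ * (g * h * g⁻¹) * g⁻¹⁻¹ = h by group] at this

/-! ### Glue vectors and conjugacy of frames -/

/-- Six times the inverse of the Gram matrix of type `A₅ + A₂ + A₁`. -/
def sixInvGram : Matrix (Fin 8) (Fin 8) ℤ :=
  !![5, 4, 3, 2, 1, 0, 0, 0;
     4, 8, 6, 4, 2, 0, 0, 0;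
     3, 6, 9, 6, 3, 0, 0, 0;
     2, 4, 6, 8, 4, 0, 0, 0;
     1, 2, 3, 4, 5, 0, 0, 0;
     0, 0, 0, 0, 0, 4, 2, 0;
     0, 0, 0, 0, 0, 2, 4, 0;
     0, 0, 0, 0, 0, 0, 0, 3]

theorem gram_mul_sixInvGram : Matrix.of gramA5A2A1 * sixInvGram = (6 : ℤ) • 1 := by
  decide +kernel

/-- The Gram matrix of the frame is nonsingular, so the frame spans `E₈` rationally. -/
theorem IsFrame.eq_zero {F : Fin 8 → Fin 8 → ℤ} (hF : IsFrame F) {z : Fin 8 → ℤ}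
    (hz : ∀ i, formE8 (F i) z = 0) : z = 0 := by
  have hG : Matrix.of F * CartanMatrix.E₈ * (Matrix.of F).transpose = Matrix.of gramA5A2A1 := by
    ext i j
    rw [Matrix.of_apply, ← hF, formE8_eq_dotProduct, Matrix.mul_assoc]
    rfl
  have hdet : (Matrix.of F * CartanMatrix.E₈).det ≠ 0 := fun h0 => by
    have h1 := congrArg Matrix.det gram_mul_sixInvGram
    rw [← hG, Matrix.det_mul, Matrix.det_mul, h0, zero_mul, zero_mul, Matrix.det_smul,
      Matrix.det_one, Fintype.card_fin] at h1
    norm_num at h1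
  refine Matrix.eq_zero_of_mulVec_eq_zero hdet ?_
  rw [← Matrix.mulVec_mulVec]
  ext i
  have := hz i
  rw [formE8_eq_dotProduct] at this
  exact this

/-- This is unimodularity: the coordinates are the integral inverse Cartan matrix applied to the
pairings. -/
theorem exists_eq_smul_of_dvd {u : Fin 8 → ℤ} {d : ℤ} (h : ∀ x, d ∣ formE8 x u) :
    ∃ y, u = d • y := by
  choose m hm using fun i => h (Pi.single i 1)
  refine ⟨invCartanE8Int.mulVec m, ?_⟩
  have hu : CartanMatrix.E₈.mulVec u = d • m := by
    ext i
    have := hm i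
    rw [formE8_eq_dotProduct, single_one_dotProduct] at this
    exact this
  rw [← Matrix.mulVec_smul, ← hu, Matrix.mulVec_mulVec, inv_mul_cartan, Matrix.one_mulVec]

/-- A generator of the group of glue vectors of `A₅`, multiplied by `6`. -/
def sixGlue (F : Fin 8 → Fin 8 → ℤ) : Fin 8 → ℤ :=
  F 0 + (2 : ℤ) • F 1 + (3 : ℤ) • F 2 + (4 : ℤ) • F 3 + (5 : ℤ) • F 4

theorem IsFrame.norm_sixGlue {F : Fin 8 → Fin 8 → ℤ} (hF : IsFrame F) :
    formE8 (sixGlue F) (sixGlue F) = 30 := by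
  simp only [sixGlue, map_add, map_smul, LinearMap.add_apply, LinearMap.smul_apply, smul_eq_mul,
    hF _ _, gramA5A2A1, Matrix.cons_val]
  norm_num

/-- The norm `30` is divisible by neither `4` nor `9`, so `sixGlue F` lies in neither `2E₈` nor
`3E₈`. Its pairings are thus onto modulo `2` and modulo `3`, and the Chinese remainder theorem
combines the two. -/
theorem IsFrame.exists_glue_mod {F : Fin 8 → Fin 8 → ℤ} (hF : IsFrame F) :
    ∃ x, formE8 x (sixGlue F) % 6 = 1 := by
  have hn := hF.norm_sixGlue
  obtain ⟨x, hx⟩ : ∃ x, ¬ (2 : ℤ) ∣ formE8 x (sixGlue F) := by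
    by_contra! hc
    obtain ⟨y, hy⟩ := exists_eq_smul_of_dvd hc
    rw [hy] at hn
    simp only [map_smul, LinearMap.smul_apply, smul_eq_mul] at hn
    omega
  obtain ⟨y, hy⟩ : ∃ x, ¬ (3 : ℤ) ∣ formE8 x (sixGlue F) := by
    by_contra! hc
    obtain ⟨y, hy⟩ := exists_eq_smul_of_dvd hc
    rw [hy] at hn
    simp only [map_smul, LinearMap.smul_apply, smul_eq_mul] at hn
    omega
  obtain h3 | h3 : formE8 y (sixGlue F) % 3 = 1 ∨ formE8 y (sixGlue F) % 3 = 2 := by omega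
  · refine ⟨(3 : ℤ) • x + (4 : ℤ) • y, ?_⟩
    simp only [map_add, map_smul, LinearMap.add_apply, LinearMap.smul_apply, smul_eq_mul]
    omega
  · refine ⟨(3 : ℤ) • x + (2 : ℤ) • y, ?_⟩
    simp only [map_add, map_smul, LinearMap.add_apply, LinearMap.smul_apply, smul_eq_mul]
    omega

/-- Functionals on `A₅` modulo those induced by `A₅` form a group of order `6`, detected by
`sixGlue`. The target has value `-5 ≡ 1`, so a vector of that class needs only a correction from
`A₅`. -/
theorem IsFrame.exists_pairing {F : Fin 8 → Fin 8 → ℤ} (hF : IsFrame F) :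
    ∃ y, formE8 (F 0) y = 0 ∧ formE8 (F 1) y = 0 ∧ formE8 (F 2) y = 0 ∧ formE8 (F 3) y = 0 ∧
      formE8 (F 4) y = -1 := by
  obtain ⟨x, hx⟩ := hF.exists_glue_mod
  rw [formE8_comm] at hx
  simp only [sixGlue, map_add, map_smul, LinearMap.add_apply, LinearMap.smul_apply,
    smul_eq_mul] at hx
  obtain ⟨m, hm⟩ : ∃ m, formE8 (F 0) x + 2 * formE8 (F 1) x + 3 * formE8 (F 2) x +
      4 * formE8 (F 3) x + 5 * (formE8 (F 4) x + 1) = 6 * m :=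
    ⟨(formE8 (F 0) x + 2 * formE8 (F 1) x + 3 * formE8 (F 2) x +
      4 * formE8 (F 3) x + 5 * (formE8 (F 4) x + 1)) / 6, by omega⟩
  -- The first coefficient comes from the first row of the inverse Gram matrix, where `m` absorbs
  -- the division by `6`. The others follow by back-substitution.
  obtain ⟨c1, h1⟩ : ∃ c, c = formE8 (F 0) x + formE8 (F 1) x + formE8 (F 2) x + formE8 (F 3) x +
    (formE8 (F 4) x + 1) - m := ⟨_, rfl⟩
  obtain ⟨c2, h2⟩ : ∃ c, c = 2 * c1 - formE8 (F 0) x := ⟨_, rfl⟩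
  obtain ⟨c3, h3⟩ : ∃ c, c = 2 * c2 - c1 - formE8 (F 1) x := ⟨_, rfl⟩
  obtain ⟨c4, h4⟩ : ∃ c, c = 2 * c3 - c2 - formE8 (F 2) x := ⟨_, rfl⟩
  obtain ⟨c5, h5⟩ : ∃ c, c = 2 * c4 - c3 - formE8 (F 3) x := ⟨_, rfl⟩
  refine ⟨x - (c1 • F 0 + c2 • F 1 + c3 • F 2 + c4 • F 3 + c5 • F 4), ?_⟩
  simp only [map_sub, map_add, map_smul, smul_eq_mul, hF _ _, gramA5A2A1, Matrix.cons_val]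
  refine ⟨?_, ?_, ?_, ?_, ?_⟩ <;> linarith

theorem IsFrame.six_smul_eq {F : Fin 8 → Fin 8 → ℤ} (hF : IsFrame F) {y : Fin 8 → ℤ}
    (h0 : formE8 (F 0) y = 0) (h1 : formE8 (F 1) y = 0) (h2 : formE8 (F 2) y = 0)
    (h3 : formE8 (F 3) y = 0) (h4 : formE8 (F 4) y = -1) :
    (6 : ℤ) • y = -sixGlue F + (4 * formE8 (F 5) y + 2 * formE8 (F 6) y) • F 5 +
      (2 * formE8 (F 5) y + 4 * formE8 (F 6) y) • F 6 + (3 * formE8 (F 7) y) • F 7 := by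
  rw [← sub_eq_zero]
  refine hF.eq_zero fun i => ?_
  simp only [sixGlue, map_sub, map_add, map_neg, map_smul, smul_eq_mul, hF _ _]
  fin_cases i <;> simp [gramA5A2A1, h0, h1, h2, h3, h4] <;> ring

theorem IsFrame.norm_eq {F : Fin 8 → Fin 8 → ℤ} (hF : IsFrame F) {y : Fin 8 → ℤ}
    (h0 : formE8 (F 0) y = 0) (h1 : formE8 (F 1) y = 0) (h2 : formE8 (F 2) y = 0)
    (h3 : formE8 (F 3) y = 0) (h4 : formE8 (F 4) y = -1) :
    6 * formE8 y y = 5 + 4 * (formE8 (F 5) y ^ 2 + formE8 (F 5) y * formE8 (F 6) y +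
      formE8 (F 6) y ^ 2) + 3 * formE8 (F 7) y ^ 2 := by
  have h := congrArg (fun z => formE8 z y) (hF.six_smul_eq h0 h1 h2 h3 h4)
  simp only [sixGlue, map_add, map_neg, map_smul, LinearMap.add_apply, LinearMap.smul_apply,
    LinearMap.neg_apply, smul_eq_mul, h0, h1, h2, h3, h4] at h
  linear_combination h

theorem formE8_self_even (x : Fin 8 → ℤ) : 2 ∣ formE8 x x :=
  ⟨x 0 ^ 2 + x 1 ^ 2 + x 2 ^ 2 + x 3 ^ 2 + x 4 ^ 2 + x 5 ^ 2 + x 6 ^ 2 + x 7 ^ 2 - x 0 * x 2 -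
    x 1 * x 3 - x 2 * x 3 - x 3 * x 4 - x 4 * x 5 - x 5 * x 6 - x 6 * x 7, by
    rw [formE8_apply]; ring⟩

/-- The frame with the simple roots of `A₂` replaced by their negatives. -/
def negateA2 (F : Fin 8 → Fin 8 → ℤ) : Fin 8 → Fin 8 → ℤ :=
  ![F 0, F 1, F 2, F 3, F 4, -F 5, -F 6, F 7]

theorem IsFrame.negA2 {F : Fin 8 → Fin 8 → ℤ} (hF : IsFrame F) : IsFrame (negateA2 F) := by
  intro i j
  fin_cases i <;> fin_cases j <;> simp [negateA2, hF _ _, gramA5A2A1]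

theorem ActsOn.negA2 {h : isometryGroup formE8} {F : Fin 8 → Fin 8 → ℤ} (hF : ActsOn h F) :
    ActsOn h (negateA2 F) := by
  intro i
  have := hF i
  fin_cases i <;> simp_all [negateA2, coxeterImage]
  abel

/-- Evenness of the norm, read modulo `2` and `3`, forces nontrivial glue on both `A₁` and `A₂`. The
two nontrivial classes of `A₂` differ by sign, so after negation a shift by `A₂ + A₁` gives the
pairings of the branch node with its neighbours. -/
theorem IsFrame.exists_glue {F : Fin 8 → Fin 8 → ℤ} (hF : IsFrame F) :
    ∃ F', (F' = F ∨ F' = negateA2 F) ∧ IsFrame F' ∧ ∃ y, formE8 (F' 0) y = 0 ∧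
      formE8 (F' 1) y = 0 ∧ formE8 (F' 2) y = 0 ∧ formE8 (F' 3) y = 0 ∧ formE8 (F' 4) y = -1 ∧
      formE8 (F' 5) y = -1 ∧ formE8 (F' 6) y = 0 ∧ formE8 (F' 7) y = -1 := by
  obtain ⟨x, h0, h1, h2, h3, h4⟩ := hF.exists_pairing
  have hn := hF.norm_eq h0 h1 h2 h3 h4
  obtain ⟨k, hk⟩ := formE8_self_even x
  have hs : formE8 (F 7) x % 2 = 1 := by
    by_contra hc
    obtain ⟨t, ht⟩ : ∃ t, formE8 (F 7) x = 2 * t := ⟨formE8 (F 7) x / 2, by omega⟩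
    rw [ht, hk] at hn
    ring_nf at hn
    omega
  have hpq : (formE8 (F 5) x - formE8 (F 6) x) % 3 ≠ 0 := by
    intro hc
    obtain ⟨t, ht⟩ : ∃ t, formE8 (F 5) x = formE8 (F 6) x + 3 * t :=
      ⟨(formE8 (F 5) x - formE8 (F 6) x) / 3, by omega⟩
    rw [ht, hk] at hn
    ring_nf at hn
    omega
  have key : ∀ F', IsFrame F' → formE8 (F' 0) x = 0 → formE8 (F' 1) x = 0 →
      formE8 (F' 2) x = 0 → formE8 (F' 3) x = 0 → formE8 (F' 4) x = -1 →
      formE8 (F' 7) x % 2 = 1 → (formE8 (F' 5) x - formE8 (F' 6) x) % 3 = 2 →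
      ∃ y, formE8 (F' 0) y = 0 ∧
      formE8 (F' 1) y = 0 ∧ formE8 (F' 2) y = 0 ∧ formE8 (F' 3) y = 0 ∧ formE8 (F' 4) y = -1 ∧
      formE8 (F' 5) y = -1 ∧ formE8 (F' 6) y = 0 ∧ formE8 (F' 7) y = -1 := by
    intro F' hF' g0 g1 g2 g3 g4 g7 g56
    obtain ⟨b, hb⟩ : ∃ b, 3 * b = formE8 (F' 5) x + 2 * formE8 (F' 6) x + 1 :=
      ⟨(formE8 (F' 5) x + 2 * formE8 (F' 6) x + 1) / 3, by omega⟩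
    obtain ⟨c, hc⟩ : ∃ c, 2 * c = formE8 (F' 7) x + 1 := ⟨(formE8 (F' 7) x + 1) / 2, by omega⟩
    refine ⟨x - ((2 * b - formE8 (F' 6) x) • F' 5 + b • F' 6 + c • F' 7), ?_⟩
    simp only [map_sub, map_add, map_smul, smul_eq_mul, hF' _ _, gramA5A2A1, Matrix.cons_val,
      g0, g1, g2, g3, g4]
    refine ⟨?_, ?_, ?_, ?_, ?_, ?_, ?_, ?_⟩ <;> linarith
  by_cases hc : (formE8 (F 5) x - formE8 (F 6) x) % 3 = 2
  · exact ⟨F, Or.inl rfl, hF, key F hF h0 h1 h2 h3 h4 hs hc⟩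
  · refine ⟨_, Or.inr rfl, hF.negA2, key _ hF.negA2 h0 h1 h2 h3 h4 hs ?_⟩
    have e5 : formE8 (negateA2 F 5) x = -formE8 (F 5) x := by simp [negateA2]
    have e6 : formE8 (negateA2 F 6) x = -formE8 (F 6) x := by simp [negateA2]
    rw [e5, e6]
    omega

/-- The frame contained in the extended Dynkin diagram of type `E₈`. -/
def stdFrame : Fin 8 → Fin 8 → ℤ :=
  ![lowestRoot, Pi.single 7 1, Pi.single 6 1, Pi.single 5 1, Pi.single 4 1, Pi.single 2 1,
    Pi.single 0 1, Pi.single 1 1]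

theorem six_smul_simple : (6 : ℤ) • (Pi.single 3 1 : Fin 8 → ℤ) = -sixGlue stdFrame +
    (-4 : ℤ) • stdFrame 5 + (-2 : ℤ) • stdFrame 6 + (-3 : ℤ) • stdFrame 7 := by
  decide +kernel

/-- Up to the sign on `A₂`, every frame is the image of the standard one under an isometry. -/
theorem IsFrame.exists_isometry {F : Fin 8 → Fin 8 → ℤ} (hF : IsFrame F) :
    ∃ F', (F' = F ∨ F' = negateA2 F) ∧ ∃ g : isometryGroup formE8, ∀ i, g.1 (stdFrame i) = F' i := by
  obtain ⟨F', hF', hfr, y, h0, h1, h2, h3, h4, h5, h6, h7⟩ := hF.exists_glue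
  refine ⟨F', hF', ?_⟩
  have hy : formE8 y y = 2 := by
    have := hfr.norm_eq h0 h1 h2 h3 h4
    rw [h5, h6, h7] at this
    omega
  -- The glue vector takes the place of the branch node; the omitted `F' 0` corresponds to the
  -- lowest root and is recovered from the relation among the nodes of the extended diagram.
  obtain ⟨g, hg⟩ := exists_isometry_of_gram ![F' 6, F' 7, F' 5, y, F' 4, F' 3, F' 2, F' 1] (by
    intro i j
    fin_cases i <;> fin_cases j <;>
      simp [hfr _ _, gramA5A2A1, CartanMatrix.E₈, formE8_comm y, h1, h2, h3, h4, h5, h6, h7, hy])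
  refine ⟨g, fun i => ?_⟩
  fin_cases i
  · have e := congrArg g.1 six_smul_simple
    have e' := hfr.six_smul_eq h0 h1 h2 h3 h4
    rw [h5, h6, h7] at e'
    simp only [sixGlue, stdFrame, map_add, map_neg, map_smul, hg, Matrix.cons_val] at e e'
    rw [e'] at e
    ext i
    have := congrFun e i
    simp only [Pi.add_apply, Pi.neg_apply, Pi.smul_apply, smul_eq_mul] at this
    change g.1 lowestRoot i = F' 0 i
    linarith
  · exact hg 7
  · exact hg 6
  · exact hg 5
  · exact hg 4
  · exact hg 2
  · exact hg 0
  · exact hg 1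

/-- The standard frame contains every simple root except the branch one, six times which lies in its
span. -/
theorem eq_of_actsOn_stdFrame {h k : isometryGroup formE8} (hh : ActsOn h stdFrame)
    (hk : ActsOn k stdFrame) : h = k := by
  have e : ∀ i, h.1 (stdFrame i) = k.1 (stdFrame i) := fun i => (hh i).trans (hk i).symm
  have e3 : h.1 (Pi.single 3 1) = k.1 (Pi.single 3 1) := by
    have h6 : (6 : ℤ) • h.1 (Pi.single 3 1) = (6 : ℤ) • k.1 (Pi.single 3 1) := by
      rw [← map_smul, ← map_smul, six_smul_simple]
      simp only [sixGlue, map_add, map_neg, map_smul, e]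
    exact smul_right_injective _ (by norm_num) h6
  apply Subtype.ext
  apply LinearEquiv.toLinearMap_injective
  refine (Pi.basisFun ℤ (Fin 8)).ext fun i => ?_
  rw [Pi.basisFun_apply]
  fin_cases i
  · exact e 6
  · exact e 7
  · exact e 5
  · exact e3
  · exact e 4
  · exact e 3
  · exact e 2
  · exact e 1

theorem ActsOn.exists_conj {h : isometryGroup formE8} {F : Fin 8 → Fin 8 → ℤ} (hF : IsFrame F)
    (hh : ActsOn h F) : ∃ g : isometryGroup formE8, ActsOn (g * h * g⁻¹) stdFrame := by
  obtain ⟨F', hF', g, hg⟩ := hF.exists_isometry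
  have hh' : ActsOn h F' := by
    rcases hF' with rfl | rfl
    · exact hh
    · exact hh.negA2
  refine ⟨g⁻¹, ?_⟩
  have := hh'.map g⁻¹
  have e : (fun i => g⁻¹.1 (F' i)) = stdFrame := by
    funext i
    rw [← hg i]
    exact g.1.symm_apply_apply _
  rwa [e] at this

/-- Two isometries that act as Coxeter elements on frames are conjugate. -/
theorem isConj_of_actsOn {h k : isometryGroup formE8} {F F' : Fin 8 → Fin 8 → ℤ}
    (hF : IsFrame F) (hF' : IsFrame F') (hh : ActsOn h F) (hk : ActsOn k F') : IsConj h k := by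
  obtain ⟨g, hg⟩ := hh.exists_conj hF
  obtain ⟨g', hg'⟩ := hk.exists_conj hF'
  have := eq_of_actsOn_stdFrame hg hg'
  exact (isConj_iff.mpr ⟨g, this⟩).trans (isConj_iff.mpr ⟨g', rfl⟩).symm

/-! ### The standard models and extension of their Weyl groups -/

theorem permA_apply {n : ℕ} (σ : Equiv.Perm (Fin (n + 1))) (x : latticeA n) (i : Fin (n + 1)) :
    ((permA σ).1 x).1 i = x.1 (σ.symm i) := rfl

theorem permA_mul_apply {n : ℕ} (σ τ : Equiv.Perm (Fin (n + 1))) (x : latticeA n) :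
    (permA (σ * τ)).1 x = (permA σ).1 ((permA τ).1 x) := rfl

/-- The root `e_i - e_j` of `A_n`. -/
def rootA {n : ℕ} (i j : Fin (n + 1)) : latticeA n :=
  ⟨Pi.single i 1 - Pi.single j 1, by
    change ∑ k, (Pi.single i 1 - Pi.single j 1 : Fin (n + 1) → ℤ) k = 0
    simp⟩

theorem formA_rootA {n : ℕ} (i j : Fin (n + 1)) (x : latticeA n) :
    formA n (rootA i j) x = x.1 i - x.1 j := by
  rw [formA_apply]
  simp [rootA, sub_mul, Pi.single_apply]

theorem permA_swap {n : ℕ} {i j : Fin (n + 1)} (hij : i ≠ j) (x : latticeA n) :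
    (permA (Equiv.swap i j)).1 x = x - formA n (rootA i j) x • rootA i j := by
  rw [formA_rootA]
  ext k
  rw [permA_apply, Equiv.symm_swap]
  change _ = x.1 k - (x.1 i - x.1 j) * (Pi.single i 1 - Pi.single j 1 : Fin (n + 1) → ℤ) k
  by_cases hi : k = i
  · subst hi
    simp [hij]
  · by_cases hj : k = j
    · subst hj
      simp [hi]
    · simp [hi, hj, Equiv.swap_apply_of_ne_of_ne hi hj]

/-- Every element of the Weyl group of a sublattice of type `A_n` extends to the whole lattice,
with trivial action on the orthogonal complement. -/
theorem exists_extension_permA {M : Type*} [AddCommGroup M] {B : LinearMap.BilinForm ℤ M}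
    (hB : ∀ x y, B x y = B y x) {n : ℕ} (ψ : latticeA n →ₗ[ℤ] M) (hψ : IsIsometric (formA n) B ψ)
    (σ : Equiv.Perm (Fin (n + 1))) :
    ∃ k : isometryGroup B, (∀ x, k.1 (ψ x) = ψ ((permA σ).1 x)) ∧
      ∀ y, (∀ z, B (ψ z) y = 0) → k.1 y = y := by
  induction σ using Equiv.Perm.swap_induction_on with
  | one => exact ⟨1, fun x => rfl, fun y _ => rfl⟩
  | swap_mul σ i j hij ih =>
    obtain ⟨k, hk, hk'⟩ := ih
    -- A transposition is the reflection in `e_i - e_j`, and the reflection in the image of that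
    -- root is defined on the whole lattice.
    have hr : B (ψ (rootA i j)) (ψ (rootA i j)) = 2 := by
      rw [hψ, formA_rootA]
      simp [rootA, hij, hij.symm]
    refine ⟨reflectionIso hB (ψ (rootA i j)) hr * k, fun x => ?_, fun y hy => ?_⟩
    · change (reflectionIso hB (ψ (rootA i j)) hr).1 (k.1 (ψ x)) = _
      rw [hk, reflectionIso_apply, hψ, permA_mul_apply, permA_swap hij, map_sub, map_smul]
    · change (reflectionIso hB (ψ (rootA i j)) hr).1 (k.1 y) = y
      rw [hk' y hy, reflectionIso_apply, hy, zero_smul, sub_zero]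

/-- The form of `A₅ ⊥ A₂ ⊥ A₁`. -/
abbrev formA5A2A1 : LinearMap.BilinForm ℤ (latticeA 5 × latticeA 2 × latticeA 1) :=
  orthSum (formA 5) (orthSum (formA 2) (formA 1))

/-- Each summand's extension fixes the other two summands, being trivial on the orthogonal
complement, so the product of the three extensions works. -/
theorem exists_extension_sum {φ : (latticeA 5 × latticeA 2 × latticeA 1) →ₗ[ℤ] (Fin 8 → ℤ)}
    (hφ : IsIsometric formA5A2A1 formE8 φ) (σ5 : Equiv.Perm (Fin 6)) (σ2 : Equiv.Perm (Fin 3))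
    (σ1 : Equiv.Perm (Fin 2)) :
    ∃ k : isometryGroup formE8, ∀ x, k.1 (φ x) =
      φ ((isometrySum (permA (n := 5) σ5)
        (isometrySum (permA (n := 2) σ2) (permA (n := 1) σ1))).1 x) := by
  let ψ5 : latticeA 5 →ₗ[ℤ] (Fin 8 → ℤ) := φ ∘ₗ LinearMap.inl ℤ _ _
  let ψ2 : latticeA 2 →ₗ[ℤ] (Fin 8 → ℤ) := φ ∘ₗ LinearMap.inr ℤ _ _ ∘ₗ LinearMap.inl ℤ _ _
  let ψ1 : latticeA 1 →ₗ[ℤ] (Fin 8 → ℤ) := φ ∘ₗ LinearMap.inr ℤ _ _ ∘ₗ LinearMap.inr ℤ _ _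
  have hsplit : ∀ x, φ x = ψ5 x.1 + ψ2 x.2.1 + ψ1 x.2.2 := fun x => by
    simp only [ψ5, ψ2, ψ1, LinearMap.comp_apply, ← map_add]
    congr 1
    simp
  have hform : ∀ x y, formE8 (φ x) (φ y) = formA 5 x.1 y.1 + (formA 2 x.2.1 y.2.1 +
      formA 1 x.2.2 y.2.2) := hφ
  obtain ⟨k5, hk5, hk5'⟩ := exists_extension_permA formE8_comm ψ5
    (fun x y => (hform _ _).trans (by simp)) σ5
  obtain ⟨k2, hk2, hk2'⟩ := exists_extension_permA formE8_comm ψ2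
    (fun x y => (hform _ _).trans (by simp)) σ2
  obtain ⟨k1, hk1, hk1'⟩ := exists_extension_permA formE8_comm ψ1
    (fun x y => (hform _ _).trans (by simp)) σ1
  have o52 : ∀ x y, formE8 (ψ5 x) (ψ2 y) = 0 := fun x y => (hform _ _).trans (by simp)
  have o51 : ∀ x y, formE8 (ψ5 x) (ψ1 y) = 0 := fun x y => (hform _ _).trans (by simp)
  have o21 : ∀ x y, formE8 (ψ2 x) (ψ1 y) = 0 := fun x y => (hform _ _).trans (by simp)
  refine ⟨k5 * k2 * k1, fun x => ?_⟩
  change k5.1 (k2.1 (k1.1 (φ x))) = _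
  have f15 : ∀ x, k1.1 (ψ5 x) = ψ5 x := fun x => hk1' _ fun z => by rw [formE8_comm, o51]
  have f12 : ∀ x, k1.1 (ψ2 x) = ψ2 x := fun x => hk1' _ fun z => by rw [formE8_comm, o21]
  have f25 : ∀ x, k2.1 (ψ5 x) = ψ5 x := fun x => hk2' _ fun z => by rw [formE8_comm, o52]
  have f21 : ∀ x, k2.1 (ψ1 x) = ψ1 x := fun x => hk2' _ fun z => o21 _ _
  have f52 : ∀ x, k5.1 (ψ2 x) = ψ2 x := fun x => hk5' _ fun z => o52 _ _
  have f51 : ∀ x, k5.1 (ψ1 x) = ψ1 x := fun x => hk5' _ fun z => o51 _ _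
  rw [hsplit, hsplit]
  simp only [map_add, hk1, hk2, hk5, f15, f12, f25, f21, f52, f51]
  rfl

/-- The standard simple roots of `A₅ ⊥ A₂ ⊥ A₁`. -/
def simpleA5A2A1 : Fin 8 → latticeA 5 × latticeA 2 × latticeA 1 :=
  ![(rootA 0 1, 0, 0), (rootA 1 2, 0, 0), (rootA 2 3, 0, 0), (rootA 3 4, 0, 0), (rootA 4 5, 0, 0),
    (0, rootA 0 1, 0), (0, rootA 1 2, 0), (0, 0, rootA 0 1)]

theorem formA5A2A1_simple (i j : Fin 8) :
    formA5A2A1 (simpleA5A2A1 i) (simpleA5A2A1 j) = gramA5A2A1 i j := by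
  have h : ∀ i j : Fin 8, ∑ a, (simpleA5A2A1 i).1.1 a * (simpleA5A2A1 j).1.1 a +
      (∑ a, (simpleA5A2A1 i).2.1.1 a * (simpleA5A2A1 j).2.1.1 a +
      ∑ a, (simpleA5A2A1 i).2.2.1 a * (simpleA5A2A1 j).2.2.1 a) = gramA5A2A1 i j := by
    decide +kernel
  rw [orthSum_apply, orthSum_apply, formA_apply, formA_apply, formA_apply]
  exact h i j

theorem finRotate_simple (i : Fin 8) :
    (isometrySum (permA (n := 5) (finRotate 6)) (isometrySum (permA (n := 2) (finRotate 3))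
      (permA (n := 1) (finRotate 2)))).1 (simpleA5A2A1 i) = coxeterImage simpleA5A2A1 i := by
  have h : ∀ i : Fin 8,
      (∀ a, (simpleA5A2A1 i).1.1 ((finRotate 6).symm a) = (coxeterImage simpleA5A2A1 i).1.1 a) ∧
      (∀ a, (simpleA5A2A1 i).2.1.1 ((finRotate 3).symm a) =
        (coxeterImage simpleA5A2A1 i).2.1.1 a) ∧
      (∀ a, (simpleA5A2A1 i).2.2.1 ((finRotate 2).symm a) =
        (coxeterImage simpleA5A2A1 i).2.2.1 a) := by
    decide +kernel
  exact Prod.ext (Subtype.ext (funext (h i).1))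
    (Prod.ext (Subtype.ext (funext (h i).2.1)) (Subtype.ext (funext (h i).2.2)))

theorem exists_mul_finRotate {n : ℕ} {σ : Equiv.Perm (Fin (n + 2))} (h1 : σ.IsCycle)
    (h2 : σ.support = Finset.univ) : ∃ τ, σ * τ = τ * finRotate (n + 2) := by
  obtain ⟨c, hc⟩ := isConj_iff.mp ((isCycle_finRotate (n := n)).isConj h1
    (by rw [h2, support_finRotate]))
  exact ⟨c, by rw [← hc]; group⟩

theorem exists_frame_of_extension
    {φ : (latticeA 5 × latticeA 2 × latticeA 1) →ₗ[ℤ] (Fin 8 → ℤ)}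
    (hφ : IsIsometric formA5A2A1 formE8 φ) {h5 : isometryGroup (formA 5)}
    {h2 : isometryGroup (formA 2)} {h1 : isometryGroup (formA 1)} (H5 : IsHA h5) (H2 : IsHA h2)
    (H1 : IsHA h1) {k : isometryGroup formE8}
    (hk : ∀ x, k.1 (φ x) = φ ((isometrySum h5 (isometrySum h2 h1)).1 x)) :
    ∃ F, IsFrame F ∧ ActsOn k F := by
  obtain ⟨σ5, c5, s5, rfl⟩ := H5
  obtain ⟨σ2, c2, s2, rfl⟩ := H2
  obtain ⟨σ1, c1, s1, rfl⟩ := H1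
  obtain ⟨τ5, e5⟩ := exists_mul_finRotate (n := 4) c5 s5
  obtain ⟨τ2, e2⟩ := exists_mul_finRotate (n := 1) c2 s2
  obtain ⟨τ1, e1⟩ := exists_mul_finRotate (n := 0) c1 s1
  set T := isometrySum (permA (n := 5) τ5) (isometrySum (permA (n := 2) τ2) (permA (n := 1) τ1))
    with hT
  -- Conjugating each cycle to `finRotate` relabels the coordinates of the models, and the
  -- relabelled simple roots form the frame.
  refine ⟨fun i => φ (T.1 (simpleA5A2A1 i)), fun i j => ?_, fun i => ?_⟩
  · rw [hφ, T.2, formA5A2A1_simple]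
  · have hc : (isometrySum (permA (n := 5) σ5) (isometrySum (permA (n := 2) σ2)
        (permA (n := 1) σ1))).1 (T.1 (simpleA5A2A1 i)) = T.1 (coxeterImage simpleA5A2A1 i) := by
      rw [← finRotate_simple]
      refine Prod.ext ?_ (Prod.ext ?_ ?_)
      · change (permA (n := 5) (σ5 * τ5)).1 _ = (permA (n := 5) (τ5 * finRotate 6)).1 _
        rw [e5]
      · change (permA (n := 2) (σ2 * τ2)).1 _ = (permA (n := 2) (τ2 * finRotate 3)).1 _
        rw [e2]
      · change (permA (n := 1) (σ1 * τ1)).1 _ = (permA (n := 1) (τ1 * finRotate 2)).1 _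
        rw [e1]
    rw [hk, hc]
    exact (coxeterImage_map (LinearMap.toAddMonoidHom (φ ∘ₗ T.1.toLinearMap)) simpleA5A2A1 i).symm

theorem isFrame_stdFrame : IsFrame stdFrame := by
  have h : ∀ i j : Fin 8, pairE8 (stdFrame i) (stdFrame j) = gramA5A2A1 i j := by decide +kernel
  exact fun i j => (formE8_apply _ _).trans (h i j)

theorem IsFrame.exists_isIsometric {F : Fin 8 → Fin 8 → ℤ} (hF : IsFrame F) :
    ∃ φ : (latticeA 5 × latticeA 2 × latticeA 1) →ₗ[ℤ] (Fin 8 → ℤ),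
      IsIsometric formA5A2A1 formE8 φ := by
  let φ : (latticeA 5 × latticeA 2 × latticeA 1) →ₗ[ℤ] (Fin 8 → ℤ) :=
    -- The coefficients of a sum-zero vector in the simple roots `e_i - e_{i+1}` are its partial
    -- sums.
    { toFun := fun x => x.1.1 0 • F 0 + (x.1.1 0 + x.1.1 1) • F 1 +
        (x.1.1 0 + x.1.1 1 + x.1.1 2) • F 2 + (x.1.1 0 + x.1.1 1 + x.1.1 2 + x.1.1 3) • F 3 +
        (x.1.1 0 + x.1.1 1 + x.1.1 2 + x.1.1 3 + x.1.1 4) • F 4 +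
        x.2.1.1 0 • F 5 + (x.2.1.1 0 + x.2.1.1 1) • F 6 + x.2.2.1 0 • F 7
      map_add' := fun x y => by
        simp only [Prod.fst_add, Prod.snd_add, Submodule.coe_add, Pi.add_apply]
        module
      map_smul' := fun c x => by
        simp only [Prod.smul_fst, Prod.smul_snd, Submodule.coe_smul, Pi.smul_apply, smul_eq_mul,
          RingHom.id_apply]
        module }
  refine ⟨φ, fun x y => ?_⟩
  rw [orthSum_apply, orthSum_apply, formA_apply, formA_apply, formA_apply]
  have sum5 : ∀ z : latticeA 5, z.1 5 = -(z.1 0 + z.1 1 + z.1 2 + z.1 3 + z.1 4) := fun z => by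
    have : ∑ i, z.1 i = 0 := z.2
    rw [Fin.sum_univ_six] at this
    linarith
  have sum2 : ∀ z : latticeA 2, z.1 2 = -(z.1 0 + z.1 1) := fun z => by
    have : ∑ i, z.1 i = 0 := z.2
    rw [Fin.sum_univ_three] at this
    linarith
  have sum1 : ∀ z : latticeA 1, z.1 1 = -z.1 0 := fun z => by
    have : ∑ i, z.1 i = 0 := z.2
    rw [Fin.sum_univ_two] at this
    linarith
  rw [Fin.sum_univ_six, Fin.sum_univ_three, Fin.sum_univ_two, sum5, sum5, sum2, sum2, sum1, sum1]
  simp only [φ, LinearMap.coe_mk, AddHom.coe_mk, map_add, map_smul, LinearMap.add_apply,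
    LinearMap.smul_apply, smul_eq_mul, hF _ _, gramA5A2A1, Matrix.cons_val]
  ring

/-- `E₈` has sublattices `A₅ ⊥ A₂ ⊥ A₁`; and if one of them is identified with the orthogonal sum
of the standard models by `φ`, then every `h_{A₅} ⊕ h_{A₂} ⊕ h_{A₁}` on it extends to an element
`k` of `O(E₈)`, and every rootless `h ∈ O(E₈)` of order `6` is conjugate to `k` in `O(E₈)`. -/
theorem theorem4p23 (h : isometryGroup formE8) (hroot : IsRootless h) (hord : orderOf h = 6) :
    (∃ φ : (latticeA 5 × latticeA 2 × latticeA 1) →ₗ[ℤ] (Fin 8 → ℤ),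
      IsIsometric (orthSum (formA 5) (orthSum (formA 2) (formA 1))) formE8 φ) ∧
    ∀ φ : (latticeA 5 × latticeA 2 × latticeA 1) →ₗ[ℤ] (Fin 8 → ℤ),
      IsIsometric (orthSum (formA 5) (orthSum (formA 2) (formA 1))) formE8 φ →
      ∀ (h5 : isometryGroup (formA 5)) (h2 : isometryGroup (formA 2))
        (h1 : isometryGroup (formA 1)), IsHA h5 → IsHA h2 → IsHA h1 →
        ∃ k : isometryGroup formE8,
          (∀ x, k.1 (φ x) = φ ((isometrySum h5 (isometrySum h2 h1)).1 x)) ∧ IsConj h k := by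
  refine ⟨isFrame_stdFrame.exists_isIsometric, fun φ hφ h5 h2 h1 H5 H2 H1 => ?_⟩
  obtain ⟨k, hk⟩ : ∃ k : isometryGroup formE8,
      ∀ x, k.1 (φ x) = φ ((isometrySum h5 (isometrySum h2 h1)).1 x) := by
    obtain ⟨σ5, -, -, rfl⟩ := H5
    obtain ⟨σ2, -, -, rfl⟩ := H2
    obtain ⟨σ1, -, -, rfl⟩ := H1
    exact exists_extension_sum hφ σ5 σ2 σ1
  obtain ⟨F, hF, hhF⟩ := hroot.exists_frame hord
  obtain ⟨F', hF', hkF'⟩ := exists_frame_of_extension hφ H5 H2 H1 hk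
  exact ⟨k, hk, isConj_of_actsOn hF hF' hhF hkF'⟩
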